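/- Let $1<p\le q<\infty$. There is a finite constant $C=C(p,q)$, depending only on $p$ and $q$, such that the following holds. Let $(\Omega,m)$ be an arbitrary measure space, and let $(T_t)_{t\ge 0}$ be a strongly continuous semigroup of linear operators on $L^1(\Omega)$ (real or complex scalars), that is, $T_0=I$, $T_{s+t}=T_sT_t$ and $t\mapsto T_tf\in L^1(\Omega)$ is continuous on $[0,\infty)$ for every $f\in L^1(\Omega)$. Assume that it satisfies the contraction property: $\|T_tf\|_{L^1}\le\|f\|_{L^1}$ for all $f\in L^1(\Omega)$, and $\|T_tf\|_{L^\infty}\le\|f\|_{L^\infty}$ for all $f\in L^1(\Omega)\cap L^\infty(\Omega)$, for every $t\ge0$. Each $T_t$ is extended by continuity from the dense subspace $L^1(\Omega)\cap L^\infty(\Omega)$ to $L^p(\Omega)$. For $f\in L^p(\Omega)$ put $A_0f=f$ and $A_\alpha f=\frac1\alpha\int_0^\alpha T_tf\,dt$ for $\alpha>0$ (a Bochner integral in $L^p(\Omega)$), and let $$M_Tf(x)=\sup_{\alpha\ge0}|A_\alpha f(x)|\qquad\text{for } m\text{-a.e. } x,$$ where for $A_\alpha f(x)$ one takes representatives such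 that, for $m$-a.e. $x$, $\alpha\mapsto A_\alpha f(x)$ is continuous on $(0,\infty)$. Let $f=(f_n)_{n\in\mathbb N}\in L^p(\ell^q)$, that is, the $f_n$ are measurable scalar functions with $$\|f\|_{L^p(\ell^q)}=\Big(\int_\Omega\Big(\sum_{n=0}^\infty|f_n(x)|^q\Big)^{p/q}dm(x)\Big)^{1/p}<\infty .$$ Then, for every $n$, $t\mapsto T_tf_n$ is Bochner integrable in $L^p(\Omega)$ over every $[0,\alpha]$, such representatives exist, $M_Tf_n$ is $m$-measurable, and $$\big\|(M_Tf_n)_{n\in\mathbb N}\big\|_{L^p(\ell^q)}\le C\,\|f\|_{L^p(\ell^q)} .$$ -/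

import Mathlib

open MeasureTheory Set Filter Topology
open scoped NNReal ENNReal

noncomputable section

namespace HopfDunfordSchwartz

/-- A semigroup `(T_t)_{t ≥ 0}` of linear operators which satisfies the contraction property (every
`T_t` is a contraction for the `L¹` norm and for the `L^∞` norm) and is strongly continuous.
The operators act on `L¹`; `contraction_top` is empty for the functions with `‖f‖_∞ = ∞`. -/
structure ContractionSemigroup (𝕜 : Type*) [RCLike 𝕜] {Ω : Type*} [MeasurableSpace Ω]
    (m : Measure Ω) where
  T : ℝ≥0 → Lp 𝕜 1 m →ₗ[𝕜] Lp 𝕜 1 m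
  map_zero : T 0 = LinearMap.id
  map_add : ∀ s t : ℝ≥0, T (s + t) = T s ∘ₗ T t
  contraction_one : ∀ (t : ℝ≥0) (f : Lp 𝕜 1 m), eLpNorm (T t f) 1 m ≤ eLpNorm f 1 m
  contraction_top : ∀ (t : ℝ≥0) (f : Lp 𝕜 1 m), eLpNorm (T t f) ∞ m ≤ eLpNorm f ∞ m
  continuous : ∀ f : Lp 𝕜 1 m, Continuous fun t : ℝ≥0 => T t f

section Extension

variable {𝕜 : Type*} [RCLike 𝕜] {Ω : Type*} [MeasurableSpace Ω] {m : Measure Ω}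

variable (𝕜 m) in
/-- The space `L¹ ∩ L^∞`. -/
def L1Linf : Submodule 𝕜 (Lp 𝕜 1 m) where
  carrier := {f | MemLp f ∞ m}
  add_mem' {f g} hf hg := (memLp_congr_ae (Lp.coeFn_add f g)).2 (MemLp.add hf hg)
  zero_mem' := (memLp_congr_ae (Lp.coeFn_zero 𝕜 1 m)).2 MemLp.zero
  smul_mem' c f hf := (memLp_congr_ae (Lp.coeFn_smul c f)).2 (MemLp.const_smul hf c)

lemma memLp_of_one_of_top {f : Ω → 𝕜} (h1 : MemLp f 1 m) (ht : MemLp f ∞ m) (p : ℝ≥0)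
    [hp : Fact (1 ≤ (p : ℝ≥0∞))] : MemLp f p m := by
  have hp1 : (1 : ℝ) ≤ p := by exact_mod_cast hp.out
  have hp0 : (p : ℝ≥0∞) ≠ 0 := (zero_lt_one.trans_le hp.out).ne'
  refine ⟨h1.1, ?_⟩
  rw [eLpNorm_lt_top_iff_lintegral_rpow_enorm_lt_top hp0 ENNReal.coe_ne_top]
  set K := eLpNorm f ∞ m with hK
  have hle : ∀ᵐ x ∂m, ‖f x‖ₑ ^ (p : ℝ) ≤ ‖f x‖ₑ * K ^ ((p : ℝ) - 1) := by
    filter_upwards [ae_le_eLpNormEssSup (f := f) (μ := m)] with x hx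
    calc ‖f x‖ₑ ^ (p : ℝ) = ‖f x‖ₑ ^ (1 + ((p : ℝ) - 1)) := by ring_nf
      _ = ‖f x‖ₑ * ‖f x‖ₑ ^ ((p : ℝ) - 1) := by
        rw [ENNReal.rpow_add_of_nonneg _ _ zero_le_one (by linarith), ENNReal.rpow_one]
      _ ≤ _ := by
        gcongr ‖f x‖ₑ * ?_
        exact ENNReal.rpow_le_rpow (by rw [hK, eLpNorm_exponent_top]; exact hx) (by linarith)
  refine (lintegral_mono_ae hle).trans_lt ?_
  rw [lintegral_mul_const'' _ h1.1.enorm]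
  refine ENNReal.mul_lt_top ?_ (ENNReal.rpow_lt_top_of_nonneg (by linarith) ht.2.ne)
  simpa [eLpNorm_one_eq_lintegral_enorm] using h1.2

variable (𝕜 m) in
/-- The inclusion of `L¹ ∩ L^∞` into `L^p`, `1 ≤ p < ∞`. -/
def inclLp (p : ℝ≥0) [Fact (1 ≤ (p : ℝ≥0∞))] : L1Linf 𝕜 m →ₗ[𝕜] Lp 𝕜 p m where
  toFun f := (memLp_of_one_of_top (Lp.memLp f.1) f.2 p).toLp f.1
  map_add' f g := by
    rw [← MemLp.toLp_add]
    exact MemLp.toLp_congr _ _ (Lp.coeFn_add f.1 g.1)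
  map_smul' c f := by
    rw [RingHom.id_apply, ← MemLp.toLp_const_smul]
    exact MemLp.toLp_congr _ _ (Lp.coeFn_smul c f.1)

lemma coeFn_inclLp (p : ℝ≥0) [Fact (1 ≤ (p : ℝ≥0∞))] (f : L1Linf 𝕜 m) :
    inclLp 𝕜 m p f =ᵐ[m] f.1 :=
  MemLp.coeFn_toLp (memLp_of_one_of_top (Lp.memLp f.1) f.2 p)

lemma denseRange_inclLp (p : ℝ≥0) [hp : Fact (1 ≤ (p : ℝ≥0∞))] :
    DenseRange (inclLp 𝕜 m p) := by
  have hp0 : (p : ℝ≥0∞) ≠ 0 := (zero_lt_one.trans_le hp.out).ne'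
  refine (Lp.simpleFunc.dense (E := 𝕜) (μ := m) (p := p) ENNReal.coe_ne_top).mono ?_
  intro g hg
  let g' : Lp.simpleFunc 𝕜 p m := ⟨g, hg⟩
  let s := Lp.simpleFunc.toSimpleFunc g'
  have hs : MemLp s p m := Lp.simpleFunc.memLp g'
  have hs1 : MemLp s 1 m := (SimpleFunc.memLp_iff one_ne_zero ENNReal.one_ne_top).2
    ((SimpleFunc.memLp_iff hp0 ENNReal.coe_ne_top).1 hs)
  refine ⟨⟨hs1.toLp s, (memLp_congr_ae hs1.coeFn_toLp).2 (SimpleFunc.memLp_top s m)⟩, ?_⟩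
  apply Lp.ext
  exact (coeFn_inclLp p _).trans
    (hs1.coeFn_toLp.trans (Lp.simpleFunc.toSimpleFunc_eq_toFun g'))

namespace ContractionSemigroup

variable (S : ContractionSemigroup 𝕜 m)

/-- The action of `T_t` on `L¹ ∩ L^∞`. -/
def onL1Linf (t : ℝ≥0) : L1Linf 𝕜 m →ₗ[𝕜] L1Linf 𝕜 m :=
  (S.T t).restrict fun f hf =>
    ⟨(Lp.memLp (S.T t f)).1, (S.contraction_top t f).trans_lt (MemLp.eLpNorm_lt_top hf)⟩

lemma meas_lt_le (t : ℝ≥0) (f : Lp 𝕜 1 m) {l : ℝ} (hl : 0 < l) :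
    m {x | l < ‖S.T t f x‖} ≤
      ENNReal.ofReal (2 / l) * ∫⁻ x in {x | l < 2 * ‖f x‖}, ‖f x‖ₑ ∂m := by
  have hfm : Measurable f := (Lp.stronglyMeasurable f).measurable
  have hA : MeasurableSet {x | l < 2 * ‖f x‖} :=
    measurableSet_lt measurable_const (hfm.norm.const_mul 2)
  have hb : MemLp ({x | l < 2 * ‖f x‖}.indicator f) 1 m := (Lp.memLp f).indicator hA
  set b : Lp 𝕜 1 m := hb.toLp _ with hbdef
  have hbc : b =ᵐ[m] {x | l < 2 * ‖f x‖}.indicator f := hb.coeFn_toLp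
  have hsm : eLpNorm (f - b : Lp 𝕜 1 m) ∞ m ≤ ENNReal.ofReal (l / 2) := by
    rw [eLpNorm_exponent_top]
    refine eLpNormEssSup_le_of_ae_bound ?_
    filter_upwards [Lp.coeFn_sub f b, hbc] with x h1 h2
    rw [h1, Pi.sub_apply, h2]
    by_cases hx : l < 2 * ‖f x‖
    · rw [indicator_of_mem (show x ∈ {x | l < 2 * ‖f x‖} from hx)]
      simp only [sub_self, norm_zero]; positivity
    · rw [indicator_of_notMem (show x ∉ {x | l < 2 * ‖f x‖} from hx), sub_zero]
      linarith
  have hsm' : ∀ᵐ x ∂m, ‖S.T t (f - b) x‖ₑ ≤ ENNReal.ofReal (l / 2) := by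
    filter_upwards [ae_le_eLpNormEssSup (f := S.T t (f - b)) (μ := m)] with x hx
    rw [← eLpNorm_exponent_top] at hx
    exact hx.trans ((S.contraction_top t _).trans hsm)
  have hsub : ∀ᵐ x ∂m, x ∈ {x | l < ‖S.T t f x‖} →
      x ∈ {x | ENNReal.ofReal (l / 2) ≤ ‖S.T t b x‖ₑ} := by
    have heq : S.T t f = S.T t (f - b) + S.T t b := by rw [← _root_.map_add, sub_add_cancel]
    filter_upwards [hsm', Lp.coeFn_add (S.T t (f - b)) (S.T t b)] with x h1 h2 h3
    change l < ‖S.T t f x‖ at h3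
    show ENNReal.ofReal (l / 2) ≤ ‖S.T t b x‖ₑ
    rw [heq, h2, Pi.add_apply] at h3
    rw [← ofReal_norm, ENNReal.ofReal_le_ofReal_iff (by positivity)] at h1
    rw [← ofReal_norm, ENNReal.ofReal_le_ofReal_iff (norm_nonneg _)]
    have := norm_add_le (S.T t (f - b) x) (S.T t b x)
    linarith
  have hl0 : ENNReal.ofReal (l / 2) ≠ 0 := by simpa using hl
  calc m {x | l < ‖S.T t f x‖}
      ≤ m {x | ENNReal.ofReal (l / 2) ≤ ‖S.T t b x‖ₑ} := measure_mono_ae hsub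
    _ ≤ (∫⁻ x, ‖S.T t b x‖ₑ ∂m) / ENNReal.ofReal (l / 2) :=
        meas_ge_le_lintegral_div (Lp.aestronglyMeasurable _).enorm hl0 ENNReal.ofReal_ne_top
    _ ≤ (∫⁻ x, ‖b x‖ₑ ∂m) / ENNReal.ofReal (l / 2) := by
        have := S.contraction_one t b
        rw [eLpNorm_one_eq_lintegral_enorm, eLpNorm_one_eq_lintegral_enorm] at this
        gcongr
    _ = (∫⁻ x in {x | l < 2 * ‖f x‖}, ‖f x‖ₑ ∂m) / ENNReal.ofReal (l / 2) := by
        rw [← lintegral_indicator hA]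
        congr 1
        refine lintegral_congr_ae ?_
        filter_upwards [hbc] with x hx
        rw [hx, enorm_indicator_eq_indicator_enorm]
    _ = _ := by
        rw [ENNReal.div_eq_inv_mul, ← ENNReal.ofReal_inv_of_pos (by positivity), inv_div]

lemma lintegral_rpow_le (t : ℝ≥0) (f : Lp 𝕜 1 m) {p : ℝ} (hp : 1 < p) :
    ∫⁻ x, ‖S.T t f x‖ₑ ^ p ∂m ≤
      ENNReal.ofReal (p * 2 ^ p / (p - 1)) * ∫⁻ x, ‖f x‖ₑ ^ p ∂m := by
  have hp0 : 0 < p := by linarith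
  have hfm : Measurable f := (Lp.stronglyMeasurable f).measurable
  have hgm : Measurable (S.T t f) := (Lp.stronglyMeasurable _).measurable
  have hR : ∀ (r : ℝ) (_ : 0 < r) (y : 𝕜), ‖y‖ₑ ^ r = ENNReal.ofReal (‖y‖ ^ r) := by
    intro r hr y
    rw [← ofReal_norm, ENNReal.ofReal_rpow_of_nonneg (norm_nonneg _) hr.le]
  set ν : Measure Ω := m.withDensity fun x => ‖f x‖ₑ with hν
  have hA : ∀ l : ℝ, MeasurableSet {x | l < 2 * ‖f x‖} := fun l =>
    measurableSet_lt measurable_const (hfm.norm.const_mul 2)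
  have key := lintegral_rpow_eq_lintegral_meas_lt_mul ν (f := fun x => 2 * ‖f x‖)
    (Eventually.of_forall fun x => by positivity) (hfm.norm.const_mul 2).aemeasurable
    (p := p - 1) (by linarith)
  have h1 : ENNReal.ofReal (2 / (p - 1)) * ENNReal.ofReal (p - 1) = 2 := by
    rw [← ENNReal.ofReal_mul (by apply div_nonneg <;> linarith),
      div_mul_cancel₀ _ (by linarith : p - 1 ≠ 0)]
    simp
  calc ∫⁻ x, ‖S.T t f x‖ₑ ^ p ∂m = ∫⁻ x, ENNReal.ofReal (‖S.T t f x‖ ^ p) ∂m := by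
        simp only [hR p hp0]
    _ = ENNReal.ofReal p *
          ∫⁻ l in Ioi (0 : ℝ), m {x | l < ‖S.T t f x‖} * ENNReal.ofReal (l ^ (p - 1)) :=
        lintegral_rpow_eq_lintegral_meas_lt_mul m (Eventually.of_forall fun x => norm_nonneg _)
          hgm.norm.aemeasurable hp0
    _ ≤ ENNReal.ofReal p * ∫⁻ l in Ioi (0 : ℝ),
          2 * (ν {x | l < 2 * ‖f x‖} * ENNReal.ofReal (l ^ (p - 1 - 1))) := by
        gcongr ENNReal.ofReal p * ?_
        refine setLIntegral_mono' measurableSet_Ioi fun l hl => ?_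
        have hl : 0 < l := hl
        rw [hν, withDensity_apply _ (hA l)]
        refine (mul_le_mul_left (S.meas_lt_le t f hl) _).trans (le_of_eq ?_)
        rw [Real.rpow_sub_one hl.ne' (p - 1), div_eq_mul_inv 2 l, div_eq_mul_inv (l ^ (p - 1)) l,
          ENNReal.ofReal_mul zero_le_two, ENNReal.ofReal_mul (Real.rpow_nonneg hl.le _)]
        simp only [ENNReal.ofReal_ofNat]
        ring
    _ = ENNReal.ofReal p * (ENNReal.ofReal (2 / (p - 1)) *
          ∫⁻ x, ENNReal.ofReal ((2 * ‖f x‖) ^ (p - 1)) ∂ν) := by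
        rw [key, ← mul_assoc (ENNReal.ofReal (2 / (p - 1))), h1,
          lintegral_const_mul' _ _ (by simp)]
    _ = ENNReal.ofReal p * (ENNReal.ofReal (2 / (p - 1)) *
          ∫⁻ x, ENNReal.ofReal (2 ^ (p - 1)) * ‖f x‖ₑ ^ p ∂m) := by
        congr 2
        rw [hν, lintegral_withDensity_eq_lintegral_mul _ hfm.enorm
          (by fun_prop)]
        refine lintegral_congr fun x => ?_
        have hsplit : ‖f x‖ₑ ^ p = ‖f x‖ₑ * ‖f x‖ₑ ^ (p - 1) := by
          conv_lhs => rw [show p = 1 + (p - 1) by ring]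
          rw [ENNReal.rpow_add_of_nonneg _ _ zero_le_one (by linarith), ENNReal.rpow_one]
        rw [Pi.mul_apply, Real.mul_rpow zero_le_two (norm_nonneg _),
          ENNReal.ofReal_mul (by positivity), hsplit, hR (p - 1) (by linarith)]
        ring
    _ = _ := by
        rw [lintegral_const_mul' _ _ ENNReal.ofReal_ne_top, ← mul_assoc, ← mul_assoc,
          ← ENNReal.ofReal_mul hp0.le,
          ← ENNReal.ofReal_mul (mul_nonneg hp0.le (div_nonneg zero_le_two (by linarith)))]
        congr 2
        rw [Real.rpow_sub_one two_ne_zero]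
        have : p - 1 ≠ 0 := by linarith
        field_simp

lemma exists_norm_le (t : ℝ≥0) (p : ℝ≥0) [hp : Fact (1 ≤ (p : ℝ≥0∞))] :
    ∃ C : ℝ, ∀ f : L1Linf 𝕜 m,
      ‖(inclLp 𝕜 m p ∘ₗ S.onL1Linf t) f‖ ≤ C * ‖inclLp 𝕜 m p f‖ := by
  have hp0 : (p : ℝ≥0∞) ≠ 0 := (zero_lt_one.trans_le hp.out).ne'
  have hp1 : (1 : ℝ) ≤ p := by exact_mod_cast hp.out
  obtain ⟨K, hK⟩ : ∃ K : ℝ≥0, ∀ f : L1Linf 𝕜 m,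
      eLpNorm (S.T t f.1) p m ≤ K * eLpNorm f.1 p m := by
    rcases hp1.eq_or_lt with h | h
    · have : p = 1 := by exact_mod_cast h.symm
      subst this
      exact ⟨1, fun f => by simpa using S.contraction_one t f.1⟩
    · refine ⟨(p * 2 ^ (p : ℝ) / (p - 1) : ℝ).toNNReal ^ (1 / (p : ℝ)), fun f => ?_⟩
      rw [eLpNorm_eq_lintegral_rpow_enorm_toReal hp0 ENNReal.coe_ne_top,
        eLpNorm_eq_lintegral_rpow_enorm_toReal hp0 ENNReal.coe_ne_top, ENNReal.coe_toReal,
        ENNReal.coe_rpow_of_nonneg _ (by positivity),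
        ← ENNReal.mul_rpow_of_nonneg _ _ (by positivity)]
      gcongr
      exact S.lintegral_rpow_le t f.1 h
  refine ⟨K, fun f => ?_⟩
  have h1 : eLpNorm (inclLp 𝕜 m p (S.onL1Linf t f)) p m = eLpNorm (S.T t f.1) p m :=
    eLpNorm_congr_ae (coeFn_inclLp p _)
  have h2 : eLpNorm (inclLp 𝕜 m p f) p m = eLpNorm f.1 p m := eLpNorm_congr_ae (coeFn_inclLp p _)
  rw [LinearMap.comp_apply, Lp.norm_def, Lp.norm_def, ← ENNReal.coe_toReal K,
    ← ENNReal.toReal_mul]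
  refine ENNReal.toReal_mono (ENNReal.mul_ne_top ENNReal.coe_ne_top (Lp.eLpNorm_ne_top _)) ?_
  rw [h1, h2]
  exact hK f

/-- The operator `T_t` on `L^p`, `1 ≤ p < ∞`: the continuous extension of its restriction to the
dense subspace `L¹ ∩ L^∞`. -/
def onLp (p : ℝ≥0) [Fact (1 ≤ (p : ℝ≥0∞))] (t : ℝ≥0) : Lp 𝕜 p m →L[𝕜] Lp 𝕜 p m :=
  (inclLp 𝕜 m p ∘ₗ S.onL1Linf t).extendOfNorm (inclLp 𝕜 m p)

/-- `onLp` really is an extension; by density and continuity it is the only one. -/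
lemma onLp_inclLp (p : ℝ≥0) [Fact (1 ≤ (p : ℝ≥0∞))] (t : ℝ≥0) (f : L1Linf 𝕜 m) :
    S.onLp p t (inclLp 𝕜 m p f) = inclLp 𝕜 m p (S.onL1Linf t f) := by
  have hd : DenseRange (inclLp 𝕜 m p) := denseRange_inclLp p
  have hn := S.exists_norm_le t p
  have h := LinearMap.extendOfNorm_eq hd hn f
  exact h

/-- The averages `A_α f = (1/α) ∫₀^α T_t f dt` of `f ∈ L^p` (a Bochner integral in `L^p`), with
`A_0 f = f`. -/
def average (p : ℝ≥0) [Fact (1 ≤ (p : ℝ≥0∞))] (f : Lp 𝕜 p m) (α : ℝ≥0) : Lp 𝕜 p m :=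
  if α = 0 then f else (α : ℝ)⁻¹ • ∫ t in (0 : ℝ)..α, S.onLp p t.toNNReal f

/-- `u α x` is a pointwise version of `A_α f (x)`: for almost every `x` it is continuous in
`α > 0`, as is `α ↦ (1/α) ∫₀^α T_t f (x) dt`. Two such versions agree, for almost every `x`, at all
`α` simultaneously. -/
def IsAverageVersion (p : ℝ≥0) [Fact (1 ≤ (p : ℝ≥0∞))] (f : Lp 𝕜 p m) (u : ℝ≥0 → Ω → 𝕜) : Prop :=
  (∀ α, u α =ᵐ[m] S.average p f α) ∧ ∀ᵐ x ∂m, ContinuousOn (fun α => u α x) (Ioi 0)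

/-- `M` is (almost everywhere) the maximal function `M_T f = sup_{α ≥ 0} |A_α f|`. -/
def IsMaximalFunction (p : ℝ≥0) [Fact (1 ≤ (p : ℝ≥0∞))] (f : Lp 𝕜 p m) (M : Ω → ℝ≥0∞) : Prop :=
  ∃ u : ℝ≥0 → Ω → 𝕜, S.IsAverageVersion p f u ∧ ∀ᵐ x ∂m, M x = ⨆ α : ℝ≥0, ‖u α x‖ₑ

end ContractionSemigroup

/-- The norm of `L^p(ℓ^q)`, `0 < p, q < ∞`, of a sequence given by its absolute values
`g n = |f n|`. -/
def lpLqNorm (p q : ℝ≥0) (m : Measure Ω) (g : ℕ → Ω → ℝ≥0∞) : ℝ≥0∞ :=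
  (∫⁻ x, (∑' n, g n x ^ (q : ℝ)) ^ ((p : ℝ) / q) ∂m) ^ (1 / (p : ℝ))

/-- `f ∈ L^p(ℓ^q)`. (A finite norm makes the `ℓ^q` norm of `f x` finite for almost every `x`.) -/
structure MemLpLq (p q : ℝ≥0) (m : Measure Ω) (f : ℕ → Ω → 𝕜) : Prop where
  aestronglyMeasurable : ∀ n, AEStronglyMeasurable (f n) m
  norm_lt_top : lpLqNorm p q m (fun n x => ‖f n x‖ₑ) < ∞

lemma MemLpLq.memLp {p q : ℝ≥0} [hp : Fact (1 ≤ (p : ℝ≥0∞))] (hpq : p ≤ q) {f : ℕ → Ω → 𝕜}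
    (hf : MemLpLq p q m f) (n : ℕ) : MemLp (f n) p m := by
  have hp0 : (p : ℝ≥0∞) ≠ 0 := (zero_lt_one.trans_le hp.out).ne'
  have hp1 : (1 : ℝ) ≤ p := by exact_mod_cast hp.out
  have hq1 : (1 : ℝ) ≤ q := hp1.trans (by exact_mod_cast hpq)
  refine ⟨hf.aestronglyMeasurable n, lt_of_le_of_lt ?_ hf.norm_lt_top⟩
  rw [eLpNorm_eq_lintegral_rpow_enorm_toReal hp0 ENNReal.coe_ne_top, ENNReal.coe_toReal, lpLqNorm]
  gcongr with x
  calc ‖f n x‖ₑ ^ (p : ℝ) = (‖f n x‖ₑ ^ (q : ℝ)) ^ ((p : ℝ) / q) := by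
        rw [← ENNReal.rpow_mul, mul_div_cancel₀ _ (by linarith : (q : ℝ) ≠ 0)]
    _ ≤ _ := by
        gcongr
        exact ENNReal.le_tsum (f := fun k => ‖f k x‖ₑ ^ (q : ℝ)) n

end Extension

end HopfDunfordSchwartz

end

/-!
The averages of the semigroup over `(0, k · 2⁻ʲ]` are the Birkhoff averages of the single operator
`T_{2⁻ʲ}` applied to `A_{2⁻ʲ} f`, and `M_T f` is almost everywhere the increasing limit in `j` of
the suprema over these dyadic grids. So it is enough to bound the maximal function of one
Dunford–Schwartz operator, uniformly in the operator.

Conditional expectation onto finite partitions reduces this to a finite matrix. The matrix of the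
absolute values of its entries is again a contraction of both `L¹` and `L^∞`, so one may assume
positivity, and Hopf's maximal lemma gives the weak type bound, hence the strong one with constant
`p / (p - 1)`.

For a sequence `v`, put `F = (∑ v_n ^ q) ^ (1 / q)` and write
`v_n = F ^ (1 - p / q) * h_n ^ (p / q)`, so that `∑ h_n ^ p = F ^ p`. By Hölder's inequality for
positive averages `M v_n ≤ (M F) ^ (1 - p / q) * (M h_n) ^ (p / q)`, and the scalar bound for `F`
and for every `h_n` gives the bound for `v`, with the same constant.
-/

namespace HopfDunfordSchwartz

/-! ### From weak type to strong type -/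

section WeakType

variable {α : Type*} [MeasurableSpace α] {μ : Measure α} {f : α → ℝ≥0∞} {g : α → ℝ≥0} {p : ℝ}

lemma lintegral_rpow_le_lintegral_mul_rpow_of_weak_type (hf : Measurable f) (hg : Measurable g)
    (h : ∀ l : ℝ≥0, l * μ {x | l < g x} ≤ ∫⁻ x in {x | l < g x}, f x ∂μ) (hp : 1 < p) :
    ENNReal.ofReal (p - 1) * ∫⁻ x, (g x : ℝ≥0∞) ^ p ∂μ ≤
      ENNReal.ofReal p * ∫⁻ x, f x * (g x : ℝ≥0∞) ^ (p - 1) ∂μ := by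
  have hp1 : 0 < p - 1 := by linarith
  have layercake : ∀ (ν : Measure α) {r : ℝ}, 0 < r → ∫⁻ x, (g x : ℝ≥0∞) ^ r ∂ν =
      ENNReal.ofReal r * ∫⁻ l in Ioi (0 : ℝ), ν {x | l < g x} * ENNReal.ofReal (l ^ (r - 1)) := by
    intro ν r hr
    rw [← lintegral_rpow_eq_lintegral_meas_lt_mul ν (f := fun x => (g x : ℝ))
      (Eventually.of_forall fun x => (g x).2) hg.coe_nnreal_real.aemeasurable hr]
    refine lintegral_congr fun x => ?_
    rw [← ENNReal.ofReal_rpow_of_nonneg NNReal.zero_le_coe hr.le, ENNReal.ofReal_coe_nnreal]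
  have hlevel : ∀ l ∈ Ioi (0 : ℝ), μ {x | l < g x} * ENNReal.ofReal (l ^ (p - 1)) ≤
      μ.withDensity f {x | l < g x} * ENNReal.ofReal (l ^ (p - 1 - 1)) := by
    intro l (hl : 0 < l)
    have hweak := h l.toNNReal
    simp only [Real.toNNReal_lt_iff_lt_coe hl.le] at hweak
    rw [withDensity_apply _ (measurableSet_lt measurable_const hg.coe_nnreal_real),
      Real.rpow_sub_one hl.ne' (p - 1)]
    calc μ {x | l < g x} * ENNReal.ofReal (l ^ (p - 1))
        = ENNReal.ofReal l * μ {x | l < g x} * ENNReal.ofReal (l ^ (p - 1) / l) := by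
          rw [mul_right_comm, ← ENNReal.ofReal_mul hl.le, mul_div_cancel₀ _ hl.ne', mul_comm]
      _ ≤ _ := by gcongr; exact hweak
  calc ENNReal.ofReal (p - 1) * ∫⁻ x, (g x : ℝ≥0∞) ^ p ∂μ
      ≤ ENNReal.ofReal (p - 1) * (ENNReal.ofReal p * ∫⁻ l in Ioi (0 : ℝ),
          μ.withDensity f {x | l < g x} * ENNReal.ofReal (l ^ (p - 1 - 1))) := by
        rw [layercake μ (by linarith)]
        gcongr _ * (_ * ?_)
        exact setLIntegral_mono' measurableSet_Ioi hlevel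
    _ = ENNReal.ofReal p * ∫⁻ x, (g x : ℝ≥0∞) ^ (p - 1) ∂μ.withDensity f := by
        rw [layercake _ hp1, mul_left_comm]
    _ = _ := by
        rw [lintegral_withDensity_eq_lintegral_mul _ hf (by fun_prop)]
        rfl

lemma lintegral_rpow_le_of_weak_type (hf : Measurable f) (hg : Measurable g)
    (h : ∀ l : ℝ≥0, l * μ {x | l < g x} ≤ ∫⁻ x in {x | l < g x}, f x ∂μ) (hp : 1 < p)
    (hfin : ∫⁻ x, (g x : ℝ≥0∞) ^ p ∂μ ≠ ∞) :
    ∫⁻ x, (g x : ℝ≥0∞) ^ p ∂μ ≤ ENNReal.ofReal (p / (p - 1)) ^ p * ∫⁻ x, f x ^ p ∂μ := by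
  have hp0 : 0 < p := by linarith
  have hp1 : 0 < p - 1 := by linarith
  have hconj : p.HolderConjugate (p / (p - 1)) := Real.HolderConjugate.conjExponent hp
  set X := ∫⁻ x, (g x : ℝ≥0∞) ^ p ∂μ
  rcases eq_or_ne X 0 with hX | hX
  · simp [hX]
  set A := (∫⁻ x, f x ^ p ∂μ) ^ (1 / p)
  have hsplit : X = X ^ (1 / p) * X ^ (1 / (p / (p - 1))) := by
    rw [← ENNReal.rpow_add_of_nonneg _ _ (by positivity) (by positivity), hconj.one_div_add_one_div,
      one_div_one, ENNReal.rpow_one]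
  have hholder : X ≤ ENNReal.ofReal (p / (p - 1)) * A * X ^ (1 / (p / (p - 1))) := by
    have hweak := (lintegral_rpow_le_lintegral_mul_rpow_of_weak_type hf hg h hp).trans
      (mul_le_mul_right (ENNReal.lintegral_mul_rpow_le_lintegral_rpow_mul_lintegral_rpow hconj
        hf.aemeasurable hg.coe_nnreal_ennreal.aemeasurable) _)
    rw [ENNReal.ofReal_div_of_pos hp1, mul_assoc, ← ENNReal.mul_div_right_comm,
      ENNReal.le_div_iff_mul_le (by simp [hp]) (by simp), mul_comm]
    exact hweak
  have hroot : X ^ (1 / p) ≤ ENNReal.ofReal (p / (p - 1)) * A := by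
    have hX' : X ^ (1 / (p / (p - 1))) ≠ 0 := by simp [hX, hfin]
    nth_rw 1 [hsplit] at hholder
    exact (ENNReal.mul_le_mul_iff_left hX'
      (ENNReal.rpow_ne_top_of_nonneg (by positivity) hfin)).1 hholder
  rwa [one_div, ENNReal.rpow_inv_le_iff hp0, ENNReal.mul_rpow_of_nonneg _ _ hp0.le,
    ← ENNReal.rpow_mul, one_div_mul_cancel hp0.ne', ENNReal.rpow_one] at hroot

end WeakType

/-! ### The norm of `L^p(ℓ^q)` for finite families -/

section MixedNorm

variable {Ω : Type*} [MeasurableSpace Ω] {m : Measure Ω} {κ : Type*} {s : Finset κ} {p q : ℝ}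
  {g h : κ → Ω → ℝ≥0∞}

/-- The norm of `L^p(ℓ^q)` of the finite family `(g n)_{n ∈ s}`; the outer exponent is written as
`(‖·‖_q) ^ p` so that Minkowski's inequality applies to it directly. -/
noncomputable def mixedNorm (p q : ℝ) (m : Measure Ω) (s : Finset κ) (g : κ → Ω → ℝ≥0∞) : ℝ≥0∞ :=
  (∫⁻ x, ((∑ n ∈ s, g n x ^ q) ^ (1 / q)) ^ p ∂m) ^ (1 / p)

lemma aemeasurable_sum_rpow_rpow (hg : ∀ n ∈ s, AEMeasurable (g n) m) :
    AEMeasurable (fun x => (∑ n ∈ s, g n x ^ q) ^ (1 / q)) m :=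
  (Finset.aemeasurable_fun_sum s fun n hn => (hg n hn).pow_const q).pow_const _

lemma mixedNorm_mono_ae (hp : 0 < p) (hq : 0 < q) (hgh : ∀ n ∈ s, g n ≤ᵐ[m] h n) :
    mixedNorm p q m s g ≤ mixedNorm p q m s h := by
  refine ENNReal.rpow_le_rpow (lintegral_mono_ae ?_) (by positivity)
  filter_upwards [(Finset.eventually_all s).2 hgh] with x hx
  gcongr with n hn
  exact hx n hn

lemma mixedNorm_congr_ae (hgh : ∀ n ∈ s, g n =ᵐ[m] h n) :
    mixedNorm p q m s g = mixedNorm p q m s h := by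
  refine congrArg (· ^ (1 / p)) (lintegral_congr_ae ?_)
  filter_upwards [(Finset.eventually_all s).2 hgh] with x hx
  rw [Finset.sum_congr rfl fun n hn => by rw [hx n hn]]

lemma mixedNorm_add_le (hp : 1 ≤ p) (hq : 1 ≤ q) (hg : ∀ n ∈ s, AEMeasurable (g n) m)
    (hh : ∀ n ∈ s, AEMeasurable (h n) m) :
    mixedNorm p q m s (g + h) ≤ mixedNorm p q m s g + mixedNorm p q m s h := by
  refine le_trans (ENNReal.rpow_le_rpow (lintegral_mono fun x => ?_) (by positivity))
    (ENNReal.lintegral_Lp_add_le (aemeasurable_sum_rpow_rpow hg) (aemeasurable_sum_rpow_rpow hh) hp)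
  exact ENNReal.rpow_le_rpow (ENNReal.Lp_add_le s (fun n => g n x) (fun n => h n x) hq)
    (by positivity)

lemma mixedNorm_le_sum (hp : 1 ≤ p) (hq : 1 ≤ q) (hg : ∀ n ∈ s, AEMeasurable (g n) m) :
    mixedNorm p q m s g ≤ ∑ n ∈ s, (∫⁻ x, g n x ^ p ∂m) ^ (1 / p) := by
  have hp0 : 0 < p := by linarith
  have hq0 : 0 < q := by linarith
  induction s using Finset.cons_induction with
  | empty => simp [mixedNorm, hp0, hq0]
  | cons a s ha ih =>
    have hs : ∀ n ∈ s, AEMeasurable (g n) m := fun n hn => hg n (Finset.mem_cons_of_mem hn)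
    have hpt : ∀ x, (∑ n ∈ s.cons a ha, g n x ^ q) ^ (1 / q) ≤
        g a x + (∑ n ∈ s, g n x ^ q) ^ (1 / q) := by
      intro x
      have := ENNReal.rpow_add_rpow_le_add (g a x) ((∑ n ∈ s, g n x ^ q) ^ (1 / q)) hq
      rwa [← ENNReal.rpow_mul, one_div_mul_cancel hq0.ne', ENNReal.rpow_one,
        ← Finset.sum_cons ha (f := fun n => g n x ^ q)] at this
    calc mixedNorm p q m (s.cons a ha) g
        ≤ (∫⁻ x, (g a x + (∑ n ∈ s, g n x ^ q) ^ (1 / q)) ^ p ∂m) ^ (1 / p) := by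
          unfold mixedNorm
          gcongr with x
          exact hpt x
      _ ≤ (∫⁻ x, g a x ^ p ∂m) ^ (1 / p) + mixedNorm p q m s g :=
          ENNReal.lintegral_Lp_add_le (hg a (Finset.mem_cons_self a s))
            (aemeasurable_sum_rpow_rpow hs) hp
      _ ≤ _ := by
          rw [Finset.sum_cons]
          gcongr
          exact ih hs

lemma lintegral_le_of_tendsto_ae {u : ℕ → Ω → ℝ≥0∞} {v : Ω → ℝ≥0∞} {B : ℝ≥0∞}
    (hu : ∀ j, AEMeasurable (u j) m) (hlim : ∀ᵐ x ∂m, Tendsto (fun j => u j x) atTop (𝓝 (v x)))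
    (hB : ∀ j, ∫⁻ x, u j x ∂m ≤ B) : ∫⁻ x, v x ∂m ≤ B :=
  calc ∫⁻ x, v x ∂m = ∫⁻ x, liminf (fun j => u j x) atTop ∂m :=
        lintegral_congr_ae (hlim.mono fun _ hx => hx.liminf_eq.symm)
    _ ≤ liminf (fun j => ∫⁻ x, u j x ∂m) atTop := lintegral_liminf_le' hu
    _ ≤ B := (liminf_le_liminf (Eventually.of_forall hB)).trans (by simp)

lemma mixedNorm_le_of_tendsto (hp : 0 < p) {u : ℕ → κ → Ω → ℝ≥0∞} {B : ℝ≥0∞}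
    (hu : ∀ j, ∀ n ∈ s, AEMeasurable (u j n) m)
    (hlim : ∀ n ∈ s, ∀ᵐ x ∂m, Tendsto (fun j => u j n x) atTop (𝓝 (g n x)))
    (hB : ∀ j, mixedNorm p q m s (u j) ≤ B) : mixedNorm p q m s g ≤ B := by
  simp only [mixedNorm, one_div p, ENNReal.rpow_inv_le_iff hp] at hB ⊢
  refine lintegral_le_of_tendsto_ae (fun j => (aemeasurable_sum_rpow_rpow (hu j)).pow_const p) ?_ hB
  filter_upwards [(Finset.eventually_all s).2 hlim] with x hx
  have hsum := tendsto_finsetSum s fun n hn => (hx n hn).ennrpow_const q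
  exact (hsum.ennrpow_const _).ennrpow_const _

lemma lpLqNorm_eq_lintegral_rpow_rpow (p q : ℝ≥0) (g : ℕ → Ω → ℝ≥0∞) :
    lpLqNorm p q m g =
      (∫⁻ x, ((∑' n, g n x ^ (q : ℝ)) ^ (1 / (q : ℝ))) ^ (p : ℝ) ∂m) ^ (1 / (p : ℝ)) := by
  simp only [lpLqNorm, ← ENNReal.rpow_mul, one_div_mul_eq_div]

lemma mixedNorm_le_lpLqNorm (p q : ℝ≥0) (s : Finset ℕ) (g : ℕ → Ω → ℝ≥0∞) :
    mixedNorm p q m s g ≤ lpLqNorm p q m g := by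
  rw [lpLqNorm_eq_lintegral_rpow_rpow, mixedNorm]
  gcongr
  exact ENNReal.sum_le_tsum s

lemma lpLqNorm_le_of_forall_mixedNorm_le {p : ℝ≥0} (q : ℝ≥0) (hp : 0 < p) {g : ℕ → Ω → ℝ≥0∞}
    {B : ℝ≥0∞} (hg : ∀ n, AEMeasurable (g n) m)
    (hB : ∀ N, mixedNorm p q m (Finset.range N) g ≤ B) : lpLqNorm p q m g ≤ B := by
  have hp : 0 < (p : ℝ) := hp
  simp only [lpLqNorm_eq_lintegral_rpow_rpow, mixedNorm, one_div (p : ℝ),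
    ENNReal.rpow_inv_le_iff hp] at hB ⊢
  refine lintegral_le_of_tendsto_ae
    (fun N => (aemeasurable_sum_rpow_rpow fun n _ => hg n).pow_const _) (.of_forall fun x => ?_) hB
  exact ((ENNReal.tendsto_nat_tsum fun n => g n x ^ (q : ℝ)).ennrpow_const _).ennrpow_const _

end MixedNorm

/-! ### Maximal inequalities for matrices -/

section Matrices

lemma lintegral_ne_top_of_finite {ι : Type*} [Finite ι] [MeasurableSpace ι]
    [MeasurableSingletonClass ι] (μ : Measure ι) [IsFiniteMeasure μ] {f : ι → ℝ≥0∞}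
    (hf : ∀ i, f i ≠ ∞) : ∫⁻ i, f i ∂μ ≠ ∞ := by
  have := Fintype.ofFinite ι
  rw [lintegral_fintype]
  exact ENNReal.sum_ne_top.2 fun i _ => ENNReal.mul_ne_top (hf i) (measure_ne_top μ _)

open Matrix

variable {ι : Type*} [Fintype ι]

/-- The matrix `b` acts as a contraction both on `ℓ^∞(ι)` and on `L¹(ι, μ)`. -/
structure IsSubstochastic [MeasurableSpace ι] (μ : Measure ι) (b : Matrix ι ι ℝ≥0) : Prop where
  row_sum_le_one : ∀ i, ∑ j, b i j ≤ 1
  sum_mul_measure_le : ∀ j, ∑ i, b i j * μ {i} ≤ μ {j}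

lemma mulVec_rpow_mul_rpow_le (a : Matrix ι ι ℝ≥0) (F h : ι → ℝ≥0) {w₁ w₂ : ℝ≥0} (hw₂ : 0 < w₂)
    (hw : w₁ + w₂ = 1) (i : ι) :
    (a *ᵥ fun j => F j ^ (w₁ : ℝ) * h j ^ (w₂ : ℝ)) i ≤
      (a *ᵥ F) i ^ (w₁ : ℝ) * (a *ᵥ h) i ^ (w₂ : ℝ) := by
  rcases eq_zero_or_pos w₁ with rfl | hw₁
  · obtain rfl : w₂ = 1 := by simpa using hw
    simp
  have hw' : (w₁ : ℝ) + w₂ = 1 := mod_cast hw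
  have hterm : ∀ j, a i j * (F j ^ (w₁ : ℝ) * h j ^ (w₂ : ℝ)) =
      (a i j * F j) ^ (w₁ : ℝ) * (a i j * h j) ^ (w₂ : ℝ) := by
    intro j
    rw [NNReal.mul_rpow, NNReal.mul_rpow, mul_mul_mul_comm,
      ← NNReal.rpow_add_of_nonneg _ w₁.coe_nonneg w₂.coe_nonneg, hw', NNReal.rpow_one]
  calc ∑ j, a i j * (F j ^ (w₁ : ℝ) * h j ^ (w₂ : ℝ))
      = ∑ j, (a i j * F j) ^ (w₁ : ℝ) * (a i j * h j) ^ (w₂ : ℝ) :=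
        Finset.sum_congr rfl fun j _ => hterm j
    _ ≤ _ := NNReal.inner_le_Lp_mul_Lq _ _ _
        (Real.holderConjugate_one_div (NNReal.coe_pos.2 hw₁) (NNReal.coe_pos.2 hw₂) hw')
    _ = (a *ᵥ F) i ^ (w₁ : ℝ) * (a *ᵥ h) i ^ (w₂ : ℝ) := by
      have hw₁ : (w₁ : ℝ) ≠ 0 := mod_cast hw₁.ne'
      have hw₂ : (w₂ : ℝ) ≠ 0 := mod_cast hw₂.ne'
      simp only [← NNReal.rpow_mul, mul_one_div_cancel hw₁, mul_one_div_cancel hw₂,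
        NNReal.rpow_one, one_div_one_div]
      rfl

lemma IsSubstochastic.lintegral_mulVec_le [MeasurableSpace ι] [DiscreteMeasurableSpace ι]
    {μ : Measure ι} {b : Matrix ι ι ℝ≥0} (hb : IsSubstochastic μ b) (f : ι → ℝ≥0) :
    ∫⁻ i, (b *ᵥ f) i ∂μ ≤ ∫⁻ i, f i ∂μ := by
  simp only [lintegral_fintype]
  calc ∑ i, ((b *ᵥ f) i : ℝ≥0∞) * μ {i} = ∑ j, f j * ∑ i, b i j * μ {i} := by
        simp only [mulVec, dotProduct, ENNReal.ofNNReal_finsetSum, ENNReal.coe_mul, Finset.sum_mul,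
          Finset.mul_sum]
        rw [Finset.sum_comm]
        exact Finset.sum_congr rfl fun j _ => Finset.sum_congr rfl fun i _ => by ring
    _ ≤ ∑ j, f j * μ {j} := by
        gcongr with j
        exact hb.sum_mul_measure_le j

variable [DecidableEq ι]

/-- The average `(1 + b + ⋯ + b ^ n) / (n + 1)`. -/
noncomputable def powerAverage (b : Matrix ι ι ℝ≥0) (n : ℕ) : Matrix ι ι ℝ≥0 :=
  ((n : ℝ≥0) + 1)⁻¹ • ∑ k ∈ Finset.range (n + 1), b ^ k

/-- The ergodic maximal function, truncated to the first `K` averages. -/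
noncomputable def maximalAverage (b : Matrix ι ι ℝ≥0) (K : ℕ) (f : ι → ℝ≥0) : ι → ℝ≥0 :=
  (Finset.range K).sup fun n => powerAverage b n *ᵥ f

lemma powerAverage_mulVec_le_maximalAverage (b : Matrix ι ι ℝ≥0) {n K : ℕ} (hn : n < K)
    (f : ι → ℝ≥0) : powerAverage b n *ᵥ f ≤ maximalAverage b K f :=
  Finset.le_sup (f := fun n => powerAverage b n *ᵥ f) (Finset.mem_range.2 hn)

lemma maximalAverage_rpow_mul_rpow_le (b : Matrix ι ι ℝ≥0) (K : ℕ) (F h : ι → ℝ≥0) {w₁ w₂ : ℝ≥0}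
    (hw₂ : 0 < w₂) (hw : w₁ + w₂ = 1) (i : ι) :
    maximalAverage b K (fun j => F j ^ (w₁ : ℝ) * h j ^ (w₂ : ℝ)) i ≤
      maximalAverage b K F i ^ (w₁ : ℝ) * maximalAverage b K h i ^ (w₂ : ℝ) := by
  rw [maximalAverage, Finset.sup_apply]
  refine Finset.sup_le fun n hn => (mulVec_rpow_mul_rpow_le _ F h hw₂ hw i).trans ?_
  gcongr <;> exact powerAverage_mulVec_le_maximalAverage b (Finset.mem_range.1 hn) _ i

/-- Garsia's function: the largest truncated excess of the sums `f + b f + ⋯ + b ^ n f`, `n < K`,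
over `(n + 1) l`. It is positive exactly where the maximal function exceeds `l`. -/
noncomputable def maximalExcess (b : Matrix ι ι ℝ≥0) (K : ℕ) (f : ι → ℝ≥0) (l : ℝ≥0) : ι → ℝ≥0 :=
  (Finset.range K).sup fun n i => ((∑ k ∈ Finset.range (n + 1), b ^ k) *ᵥ f) i - (n + 1) * l

lemma lt_maximalAverage_iff (b : Matrix ι ι ℝ≥0) (K : ℕ) (f : ι → ℝ≥0) (l : ℝ≥0) (i : ι) :
    l < maximalAverage b K f i ↔ 0 < maximalExcess b K f l i := by
  simp only [maximalAverage, maximalExcess, Finset.sup_apply, Finset.lt_sup_iff]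
  refine exists_congr fun n => and_congr_right fun _ => ?_
  rw [powerAverage, smul_mulVec, Pi.smul_apply, smul_eq_mul, tsub_pos_iff_lt,
    lt_inv_mul_iff₀ (by positivity)]

lemma exists_maximalExcess_eq {b : Matrix ι ι ℝ≥0} {K : ℕ} {f : ι → ℝ≥0} {l : ℝ≥0} {i : ι}
    (hi : 0 < maximalExcess b K f l i) : ∃ n < K,
      maximalExcess b K f l i = ((∑ k ∈ Finset.range (n + 1), b ^ k) *ᵥ f) i - (n + 1) * l := by
  rw [maximalExcess, Finset.sup_apply] at hi ⊢
  have hK : (Finset.range K).Nonempty := by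
    by_contra hK
    simp [Finset.not_nonempty_iff_eq_empty.1 hK] at hi
  obtain ⟨n, hn, hin⟩ := Finset.exists_mem_eq_sup _ hK
    fun n : ℕ => ((∑ k ∈ Finset.range (n + 1), b ^ k) *ᵥ f) i - (n + 1) * l
  exact ⟨n, Finset.mem_range.1 hn, hin⟩

variable [MeasurableSpace ι] {μ : Measure ι} {b : Matrix ι ι ℝ≥0}

lemma IsSubstochastic.maximalExcess_add_le (hb : IsSubstochastic μ b) {K : ℕ} {f : ι → ℝ≥0}
    {l : ℝ≥0} {i : ι} (hi : 0 < maximalExcess b K f l i) :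
    maximalExcess b K f l i + l ≤ f i + (b *ᵥ maximalExcess b K f l) i := by
  set h := maximalExcess b K f l
  obtain ⟨n, hn, hin⟩ := exists_maximalExcess_eq hi
  have hsum : (∑ k ∈ Finset.range n, b ^ k) *ᵥ f ≤ fun j => h j + n * l := by
    rcases n with _ | n
    · simp
    · intro j
      have hle := Finset.le_sup (f := fun n i =>
        ((∑ k ∈ Finset.range (n + 1), b ^ k) *ᵥ f) i - (n + 1) * l)
        (Finset.mem_range.2 (n.lt_succ_self.trans hn)) j
      push_cast
      exact tsub_le_iff_right.1 hle
  have hstep : ((∑ k ∈ Finset.range (n + 1), b ^ k) *ᵥ f) i ≤ f i + (b *ᵥ h) i + n * l :=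
    calc ((∑ k ∈ Finset.range (n + 1), b ^ k) *ᵥ f) i
        = f i + ∑ j, b i j * ((∑ k ∈ Finset.range n, b ^ k) *ᵥ f) j := by
          rw [geom_sum_succ, add_mulVec, one_mulVec, ← mulVec_mulVec, Pi.add_apply, add_comm]
          rfl
      _ ≤ f i + ∑ j, b i j * (h j + n * l) := by
          gcongr with j
          exact hsum j
      _ = f i + (b *ᵥ h) i + (∑ j, b i j) * (n * l) := by
          simp only [mul_add, Finset.sum_add_distrib, Finset.sum_mul, add_assoc]
          rfl
      _ ≤ f i + (b *ᵥ h) i + n * l := by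
          gcongr f i + (b *ᵥ h) i + ?_
          exact mul_le_of_le_one_left zero_le (hb.row_sum_le_one i)
  have hexcess : h i + (n + 1) * l ≤ f i + (b *ᵥ h) i + n * l := by
    rw [show h i = _ from hin, tsub_add_cancel_of_le (tsub_pos_iff_lt.1 (hin ▸ hi)).le]
    exact hstep
  rw [add_one_mul, add_left_comm, add_comm (f i + _)] at hexcess
  exact le_of_add_le_add_left hexcess

variable [DiscreteMeasurableSpace ι] [IsFiniteMeasure μ]

lemma IsSubstochastic.mul_measure_lt_maximalAverage_le (hb : IsSubstochastic μ b) (K : ℕ)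
    (f : ι → ℝ≥0) (l : ℝ≥0) :
    l * μ {i | l < maximalAverage b K f i} ≤ ∫⁻ i in {i | l < maximalAverage b K f i}, f i ∂μ := by
  simp only [lt_maximalAverage_iff]
  set h := maximalExcess b K f l
  set A := {i | 0 < h i}
  have hA : ∫⁻ i in A, h i ∂μ = ∫⁻ i, h i ∂μ := by
    rw [← lintegral_indicator (.of_discrete)]
    refine lintegral_congr fun i => ?_
    by_cases hi : i ∈ A
    · rw [indicator_of_mem hi]
    · have hi : h i = 0 := by simpa [A] using hi
      simp [hi]
  have hfin : ∫⁻ i, h i ∂μ ≠ ∞ := lintegral_ne_top_of_finite μ fun i => ENNReal.coe_ne_top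
  refine (ENNReal.add_le_add_iff_left hfin).1 ?_
  calc ∫⁻ i, h i ∂μ + l * μ A = ∫⁻ i in A, (h i + l : ℝ≥0) ∂μ := by
        simp only [ENNReal.coe_add]
        rw [lintegral_add_right _ measurable_const, hA, setLIntegral_const]
    _ ≤ ∫⁻ i in A, (f i + (b *ᵥ h) i : ℝ≥0) ∂μ :=
        setLIntegral_mono' .of_discrete fun i hi =>
          ENNReal.coe_le_coe.2 (hb.maximalExcess_add_le hi)
    _ = ∫⁻ i in A, (b *ᵥ h) i ∂μ + ∫⁻ i in A, f i ∂μ := by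
        simp only [ENNReal.coe_add]
        rw [lintegral_add_left .of_discrete, add_comm]
    _ ≤ ∫⁻ i, h i ∂μ + ∫⁻ i in A, f i ∂μ := by
        gcongr ?_ + _
        exact (setLIntegral_le_lintegral _ _).trans (hb.lintegral_mulVec_le h)

lemma IsSubstochastic.lintegral_maximalAverage_rpow_le (hb : IsSubstochastic μ b) (K : ℕ)
    (f : ι → ℝ≥0) {p : ℝ} (hp : 1 < p) :
    ∫⁻ i, (maximalAverage b K f i : ℝ≥0∞) ^ p ∂μ ≤
      ENNReal.ofReal (p / (p - 1)) ^ p * ∫⁻ i, (f i : ℝ≥0∞) ^ p ∂μ :=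
  lintegral_rpow_le_of_weak_type .of_discrete .of_discrete
    (hb.mul_measure_lt_maximalAverage_le K f) hp
    (lintegral_ne_top_of_finite μ fun _ =>
      ENNReal.rpow_ne_top_of_nonneg (by linarith) ENNReal.coe_ne_top)

end Matrices

/-! ### The vector-valued maximal inequality for matrices -/

section VectorValued

variable {κ : Type*} {s : Finset κ} {p q w₁ w₂ : ℝ≥0}

/- With `F = (∑ v n ^ q) ^ (1 / q)`, take `h n = v n ^ (q / p) * F ^ (1 - q / p)`. -/
lemma exists_eq_rpow_mul_rpow (v : κ → ℝ≥0) (hp : 0 < p) (hw₂ : 0 < w₂) (hw : w₁ + w₂ = 1)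
    (hpq : w₂ * q = p) : ∃ h : κ → ℝ≥0,
      (∀ n ∈ s, v n = ((∑ n ∈ s, v n ^ (q : ℝ)) ^ (1 / (q : ℝ))) ^ (w₁ : ℝ) * h n ^ (w₂ : ℝ)) ∧
      ∑ n ∈ s, h n ^ (p : ℝ) = ((∑ n ∈ s, v n ^ (q : ℝ)) ^ (1 / (q : ℝ))) ^ (p : ℝ) := by
  have hq : (q : ℝ) ≠ 0 := by
    rintro h
    rw [NNReal.coe_eq_zero.1 h, mul_zero] at hpq
    exact hp.ne hpq
  have hp' : (p : ℝ) ≠ 0 := mod_cast hp.ne'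
  have hw₂' : (w₂ : ℝ) ≠ 0 := mod_cast hw₂.ne'
  have hw' : (w₁ : ℝ) = 1 - w₂ := eq_sub_of_add_eq (mod_cast hw)
  have hpq' : (w₂ : ℝ) * q = p := mod_cast hpq
  generalize hFv : (∑ n ∈ s, v n ^ (q : ℝ)) ^ (1 / (q : ℝ)) = F
  have hF : F ^ (q : ℝ) = ∑ n ∈ s, v n ^ (q : ℝ) := by
    rw [← hFv, ← NNReal.rpow_mul, one_div_mul_cancel hq, NNReal.rpow_one]
  rcases eq_or_ne F 0 with hF0 | hF0
  · have hv : ∀ n ∈ s, v n = 0 := by simpa [hF0, hq] using hF.symm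
    exact ⟨0, fun n hn => by simp [hv n hn, hw₂'], by simp [hF0, hp']⟩
  · refine ⟨fun n => v n ^ (w₂⁻¹ : ℝ) * F ^ (1 - (w₂⁻¹ : ℝ)), fun n _ => ?_, ?_⟩
    · rw [NNReal.mul_rpow, ← NNReal.rpow_mul, ← NNReal.rpow_mul, inv_mul_cancel₀ hw₂',
        NNReal.rpow_one, mul_left_comm, ← NNReal.rpow_add hF0, hw', sub_mul, inv_mul_cancel₀ hw₂']
      simp
    · simp only [NNReal.mul_rpow, ← NNReal.rpow_mul, ← Finset.sum_mul, ← hpq',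
        inv_mul_cancel_left₀ hw₂']
      rw [← hF, ← NNReal.rpow_add hF0, sub_mul, inv_mul_cancel_left₀ hw₂']
      ring_nf

lemma rpow_sum_rpow_le_of_le_rpow_mul_rpow {a h : κ → ℝ≥0} {A : ℝ≥0} (hq : 0 < q)
    (hw : w₁ + w₂ = 1) (hpq : w₂ * q = p)
    (ha : ∀ n ∈ s, a n ≤ A ^ (w₁ : ℝ) * h n ^ (w₂ : ℝ)) :
    ((∑ n ∈ s, a n ^ (q : ℝ)) ^ (1 / (q : ℝ))) ^ (p : ℝ) ≤
      w₁ * A ^ (p : ℝ) + w₂ * ∑ n ∈ s, h n ^ (p : ℝ) := by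
  have hpq' : (p : ℝ) = w₂ * q := mod_cast hpq.symm
  have hq' : (q : ℝ) ≠ 0 := mod_cast hq.ne'
  calc ((∑ n ∈ s, a n ^ (q : ℝ)) ^ (1 / (q : ℝ))) ^ (p : ℝ)
      = (∑ n ∈ s, a n ^ (q : ℝ)) ^ (w₂ : ℝ) := by
        rw [← NNReal.rpow_mul, hpq', one_div_mul_eq_div, mul_div_cancel_right₀ _ hq']
    _ ≤ (∑ n ∈ s, (A ^ (w₁ : ℝ) * h n ^ (w₂ : ℝ)) ^ (q : ℝ)) ^ (w₂ : ℝ) := by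
        gcongr with n hn
        exact ha n hn
    _ = (A ^ (p : ℝ)) ^ (w₁ : ℝ) * (∑ n ∈ s, h n ^ (p : ℝ)) ^ (w₂ : ℝ) := by
        simp only [NNReal.mul_rpow, ← NNReal.rpow_mul, ← Finset.mul_sum, hpq']
        ring_nf
    _ ≤ _ := NNReal.geom_mean_le_arith_mean2_weighted _ _ _ _ hw

lemma mixedNorm_coe {Ω : Type*} [MeasurableSpace Ω] (m : Measure Ω) (g : κ → Ω → ℝ≥0) :
    mixedNorm p q m s (fun n x => g n x) =
      (∫⁻ x, (((∑ n ∈ s, g n x ^ (q : ℝ)) ^ (1 / (q : ℝ))) ^ (p : ℝ) : ℝ≥0) ∂m) ^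
        (1 / (p : ℝ)) := by
  simp only [mixedNorm, ENNReal.coe_rpow_of_nonneg _ p.coe_nonneg,
    ENNReal.coe_rpow_of_nonneg _ q.coe_nonneg,
    ENNReal.coe_rpow_of_nonneg _ (one_div_nonneg.2 q.coe_nonneg), ENNReal.ofNNReal_finsetSum]

variable {ι : Type*} [Fintype ι] [DecidableEq ι]

lemma exists_rpow_sum_maximalAverage_le (b : Matrix ι ι ℝ≥0) (K : ℕ) (hp : 0 < p) (hpq : p ≤ q)
    (v : κ → ι → ℝ≥0) : ∃ (F : ι → ℝ≥0) (h : κ → ι → ℝ≥0),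
      (∀ i, F i = (∑ n ∈ s, v n i ^ (q : ℝ)) ^ (1 / (q : ℝ))) ∧
      (∀ i, ∑ n ∈ s, h n i ^ (p : ℝ) = F i ^ (p : ℝ)) ∧
      ∀ i, ((∑ n ∈ s, maximalAverage b K (v n) i ^ (q : ℝ)) ^ (1 / (q : ℝ))) ^ (p : ℝ) ≤
        (1 - p / q) * maximalAverage b K F i ^ (p : ℝ) +
          p / q * ∑ n ∈ s, maximalAverage b K (h n) i ^ (p : ℝ) := by
  have hq : 0 < q := hp.trans_le hpq
  have hw₂ : 0 < p / q := by positivity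
  have hw : 1 - p / q + p / q = 1 := tsub_add_cancel_of_le (div_le_one_of_le₀ hpq zero_le)
  have hθ : p / q * q = p := div_mul_cancel₀ _ hq.ne'
  choose h hv hsum using fun i => exists_eq_rpow_mul_rpow (s := s) (fun n => v n i) hp hw₂ hw hθ
  refine ⟨_, fun n i => h i n, fun i => rfl, hsum, fun i => ?_⟩
  refine rpow_sum_rpow_le_of_le_rpow_mul_rpow hq hw hθ fun n hn => ?_
  refine le_trans (le_of_eq ?_) (maximalAverage_rpow_mul_rpow_le b K _ (h · n) hw₂ hw i)
  congr 1
  exact funext fun i => hv i n hn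

lemma IsSubstochastic.mixedNorm_maximalAverage_le [MeasurableSpace ι] [DiscreteMeasurableSpace ι]
    {μ : Measure ι} [IsFiniteMeasure μ] {b : Matrix ι ι ℝ≥0} (hb : IsSubstochastic μ b) (K : ℕ)
    (hp : 1 < p) (hpq : p ≤ q) (v : κ → ι → ℝ≥0) :
    mixedNorm p q μ s (fun n i => maximalAverage b K (v n) i) ≤
      ENNReal.ofReal (p / (p - 1)) * mixedNorm p q μ s (fun n i => v n i) := by
  have hp0 : (0 : ℝ) < p := zero_lt_one.trans (mod_cast hp)
  have hw : 1 - p / q + p / q = 1 := tsub_add_cancel_of_le (div_le_one_of_le₀ hpq zero_le)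
  obtain ⟨F, h, hF, hsum, hpointwise⟩ :=
    exists_rpow_sum_maximalAverage_le (s := s) b K (zero_lt_one.trans hp) hpq v
  rw [mixedNorm_coe, mixedNorm_coe, one_div (p : ℝ), ENNReal.rpow_inv_le_iff hp0,
    ENNReal.mul_rpow_of_nonneg _ _ hp0.le, ENNReal.rpow_inv_rpow hp0.ne']
  simp only [← hF]
  set c := ENNReal.ofReal (p / (p - 1)) ^ (p : ℝ)
  have hmax : ∀ f : ι → ℝ≥0, ∫⁻ i, (maximalAverage b K f i ^ (p : ℝ) : ℝ≥0) ∂μ ≤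
      c * ∫⁻ i, (f i ^ (p : ℝ) : ℝ≥0) ∂μ := by
    simpa only [ENNReal.coe_rpow_of_nonneg _ p.coe_nonneg] using
      fun f => hb.lintegral_maximalAverage_rpow_le K f (NNReal.one_lt_coe.2 hp)
  calc _ ≤ ∫⁻ i, ((1 - p / q) * maximalAverage b K F i ^ (p : ℝ) +
          p / q * ∑ n ∈ s, maximalAverage b K (h n) i ^ (p : ℝ) : ℝ≥0) ∂μ :=
        lintegral_mono fun i => ENNReal.coe_le_coe.2 (hpointwise i)
    _ = (1 - p / q : ℝ≥0) * ∫⁻ i, (maximalAverage b K F i ^ (p : ℝ) : ℝ≥0) ∂μ +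
          (p / q : ℝ≥0) * ∑ n ∈ s, ∫⁻ i, (maximalAverage b K (h n) i ^ (p : ℝ) : ℝ≥0) ∂μ := by
        simp only [ENNReal.coe_add, ENNReal.coe_mul, ENNReal.ofNNReal_finsetSum]
        rw [lintegral_add_left .of_discrete, lintegral_const_mul _ .of_discrete,
          lintegral_const_mul _ .of_discrete, lintegral_finsetSum _ fun _ _ => .of_discrete]
    _ ≤ (1 - p / q : ℝ≥0) * (c * ∫⁻ i, (F i ^ (p : ℝ) : ℝ≥0) ∂μ) +
          (p / q : ℝ≥0) * ∑ n ∈ s, c * ∫⁻ i, (h n i ^ (p : ℝ) : ℝ≥0) ∂μ := by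
        gcongr <;> exact hmax _
    _ = ((1 - p / q : ℝ≥0) + (p / q : ℝ≥0)) * (c * ∫⁻ i, (F i ^ (p : ℝ) : ℝ≥0) ∂μ) := by
        rw [← Finset.mul_sum, ← lintegral_finsetSum _ fun _ _ => .of_discrete, add_mul]
        simp only [← ENNReal.ofNNReal_finsetSum, hsum]
    _ = c * ∫⁻ i, (F i ^ (p : ℝ) : ℝ≥0) ∂μ := by
        rw [← ENNReal.coe_add, hw, ENNReal.coe_one, one_mul]

end VectorValued

/-! ### Finite partitions and conditional means -/

section FinitePartition

variable {𝕜 : Type*} [RCLike 𝕜] {Ω : Type*} [MeasurableSpace Ω]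

lemma enorm_average_le_eLpNorm {μ : Measure Ω} [IsFiniteMeasure μ] {r : ℝ≥0∞} (hr : 1 ≤ r)
    {f : Ω → 𝕜} (hf : AEStronglyMeasurable f μ) :
    ‖⨍ x, f x ∂μ‖ₑ ≤ eLpNorm f r ((μ univ)⁻¹ • μ) := by
  rcases eq_zero_or_neZero μ with rfl | _
  · simp
  calc ‖⨍ x, f x ∂μ‖ₑ ≤ eLpNorm f 1 ((μ univ)⁻¹ • μ) := by
        rw [eLpNorm_one_eq_lintegral_enorm, average_eq']
        exact enorm_integral_le_lintegral_enorm _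
    _ ≤ eLpNorm f r ((μ univ)⁻¹ • μ) :=
        eLpNorm_le_eLpNorm_of_exponent_le hr (hf.smul_measure _)

lemma measure_univ_mul_enorm_average_rpow_le {μ : Measure Ω} [IsFiniteMeasure μ] {r : ℝ≥0∞}
    (hr : 1 ≤ r) (hr' : r ≠ ∞) {f : Ω → 𝕜} (hf : AEStronglyMeasurable f μ) :
    μ univ * ‖⨍ x, f x ∂μ‖ₑ ^ r.toReal ≤ ∫⁻ x, ‖f x‖ₑ ^ r.toReal ∂μ := by
  rcases eq_zero_or_neZero μ with rfl | _
  · simp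
  have hr0 : 0 < r.toReal := ENNReal.toReal_pos (zero_lt_one.trans_le hr).ne' hr'
  have hmean := enorm_average_le_eLpNorm hr hf
  rw [eLpNorm_eq_lintegral_rpow_enorm_toReal (zero_lt_one.trans_le hr).ne' hr', one_div,
    ENNReal.le_rpow_inv_iff hr0, lintegral_smul_measure, smul_eq_mul] at hmean
  calc μ univ * ‖⨍ x, f x ∂μ‖ₑ ^ r.toReal
      ≤ μ univ * ((μ univ)⁻¹ * ∫⁻ x, ‖f x‖ₑ ^ r.toReal ∂μ) := by gcongr
    _ = ∫⁻ x, ‖f x‖ₑ ^ r.toReal ∂μ :=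
      ENNReal.mul_inv_cancel_left (NeZero.ne _) (measure_ne_top μ _)

/-- A finite measurable partition of a set `region` of finite measure: the cell with label `i`
consists of the points of `region` at which `index` takes the value `i`. -/
structure FinitePartition (m : Measure Ω) (ι : Type*) [MeasurableSpace ι] where
  region : Set Ω
  measurableSet_region : MeasurableSet region
  measure_region_ne_top : m region ≠ ∞
  index : Ω → ι
  measurable_index : Measurable index

namespace FinitePartition

variable {m : Measure Ω} {ι : Type*} [MeasurableSpace ι] (A : FinitePartition m ι)

/-- The measure on the labels which gives each label the measure of its cell. -/
noncomputable def weight : Measure ι := (m.restrict A.region).map A.index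

instance : IsFiniteMeasure A.weight := by
  have : IsFiniteMeasure (m.restrict A.region) :=
    isFiniteMeasure_restrict.2 A.measure_region_ne_top
  exact inferInstanceAs (IsFiniteMeasure ((m.restrict A.region).map A.index))

/-- The set of points of `region` with label `i`. -/
def cell (i : ι) : Set Ω := A.region ∩ A.index ⁻¹' {i}

/-- The function equal to `c i` on the cell `i`, and to `0` outside `region`. -/
noncomputable def stepFun {M : Type*} [Zero M] (c : ι → M) : Ω → M :=
  A.region.indicator (c ∘ A.index)

/-- The mean values over the cells; the mean over a null cell is `0`. -/
noncomputable def mean (f : Ω → 𝕜) (i : ι) : 𝕜 := ⨍ x in A.cell i, f x ∂m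

lemma map_stepFun {M N : Type*} [Zero M] [Zero N] {φ : M → N} (hφ : φ 0 = 0) (c : ι → M) (x : Ω) :
    φ (A.stepFun c x) = A.stepFun (φ ∘ c) x :=
  congrFun (indicator_comp_of_zero hφ).symm x

lemma stepFun_congr_ae {M : Type*} [Zero M] {c d : ι → M} (h : c =ᵐ[A.weight] d) :
    A.stepFun c =ᵐ[m] A.stepFun d :=
  (ae_eq_restrict_iff_indicator_ae_eq A.measurableSet_region).1 <|
    ae_of_ae_map A.measurable_index.aemeasurable h

lemma mean_congr_ae {f g : Ω → 𝕜} (h : f =ᵐ[m] g) : A.mean f = A.mean g :=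
  funext fun _ => average_congr (ae_restrict_of_ae h)

variable [DiscreteMeasurableSpace ι]

lemma measurableSet_cell (i : ι) : MeasurableSet (A.cell i) :=
  A.measurableSet_region.inter (A.measurable_index .of_discrete)

lemma weight_singleton (i : ι) : A.weight {i} = m (A.cell i) := by
  rw [weight, Measure.map_apply A.measurable_index .of_discrete,
    Measure.restrict_apply (A.measurable_index .of_discrete), inter_comm, cell]

instance (i : ι) : IsFiniteMeasure (m.restrict (A.cell i)) :=
  isFiniteMeasure_restrict.2 (A.weight_singleton i ▸ measure_ne_top _ _)

lemma eLpNorm_stepFun [Countable ι] (c : ι → 𝕜) (r : ℝ≥0∞) :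
    eLpNorm (A.stepFun c) r m = eLpNorm c r A.weight := by
  rw [stepFun, eLpNorm_indicator_eq_eLpNorm_restrict A.measurableSet_region, weight,
    eLpNorm_map_measure .of_discrete A.measurable_index.aemeasurable]

lemma memLp_stepFun [Finite ι] (c : ι → 𝕜) (r : ℝ≥0∞) : MemLp (A.stepFun c) r m := by
  rw [stepFun, memLp_indicator_iff_restrict A.measurableSet_region,
    ← memLp_map_measure_iff .of_discrete A.measurable_index.aemeasurable]
  exact MemLp.of_discrete (μ := A.weight)

lemma mixedNorm_stepFun {κ : Type*} {p q : ℝ} (hp : 0 < p) (hq : 0 < q) (s : Finset κ)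
    (v : κ → ι → ℝ≥0∞) :
    mixedNorm p q m s (fun n => A.stepFun (v n)) = mixedNorm p q A.weight s v := by
  have hstep : ∀ x, ((∑ n ∈ s, A.stepFun (v n) x ^ q) ^ (1 / q)) ^ p =
      A.stepFun (fun i => ((∑ n ∈ s, v n i ^ q) ^ (1 / q)) ^ p) x := by
    intro x
    by_cases hx : x ∈ A.region <;> simp [stepFun, hx, hp, hq]
  simp only [mixedNorm, hstep]
  rw [stepFun, lintegral_indicator A.measurableSet_region, weight,
    lintegral_map .of_discrete A.measurable_index]
  rfl

lemma mean_stepFun_ae_eq [Countable ι] (c : ι → 𝕜) : A.mean (A.stepFun c) =ᵐ[A.weight] c := by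
  refine (ae_iff_of_countable ..).2 fun i hi => ?_
  rw [A.weight_singleton] at hi
  have hcell : ∀ x ∈ A.cell i, A.stepFun c x = c i := by
    rintro x ⟨hx, rfl : A.index x = i⟩
    exact indicator_of_mem hx _
  rw [mean, setAverage_congr_fun (A.measurableSet_cell i) (.of_forall hcell),
    setAverage_const hi (A.weight_singleton i ▸ measure_ne_top _ _)]

lemma enorm_mean_le_eLpNorm_top {f : Ω → 𝕜} (hf : AEStronglyMeasurable f m) (i : ι) :
    ‖A.mean f i‖ₑ ≤ eLpNorm f ∞ m :=
  calc ‖A.mean f i‖ₑ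
      ≤ eLpNorm f ∞ ((m.restrict (A.cell i) univ)⁻¹ • m.restrict (A.cell i)) :=
        enorm_average_le_eLpNorm le_top hf.restrict
    _ ≤ eLpNorm f ∞ m :=
        eLpNormEssSup_mono_measure _ (Measure.smul_absolutelyContinuous.trans
          Measure.absolutelyContinuous_restrict)

lemma eLpNorm_mean_le [Finite ι] {r : ℝ≥0∞} (hr : 1 ≤ r) (hr' : r ≠ ∞) {f : Ω → 𝕜}
    (hf : AEStronglyMeasurable f m) : eLpNorm (A.mean f) r A.weight ≤ eLpNorm f r m := by
  have := Fintype.ofFinite ι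
  have hr0 : r ≠ 0 := (zero_lt_one.trans_le hr).ne'
  simp only [eLpNorm_eq_lintegral_rpow_enorm_toReal hr0 hr']
  refine ENNReal.rpow_le_rpow ?_ (by positivity)
  calc ∫⁻ i, ‖A.mean f i‖ₑ ^ r.toReal ∂A.weight
      = ∑ i, m.restrict (A.cell i) univ * ‖A.mean f i‖ₑ ^ r.toReal := by
        simp only [lintegral_fintype, A.weight_singleton, Measure.restrict_apply_univ, mul_comm]
    _ ≤ ∑ i, ∫⁻ x in A.cell i, ‖f x‖ₑ ^ r.toReal ∂m :=
        Finset.sum_le_sum fun i _ => measure_univ_mul_enorm_average_rpow_le hr hr' hf.restrict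
    _ = ∫⁻ x in ⋃ i, A.cell i, ‖f x‖ₑ ^ r.toReal ∂m := by
        rw [lintegral_iUnion A.measurableSet_cell, tsum_fintype]
        exact fun i j hij => disjoint_left.2 fun x hi hj => hij (hi.2.symm.trans hj.2)
    _ ≤ ∫⁻ x, ‖f x‖ₑ ^ r.toReal ∂m := setLIntegral_le_lintegral _ _

section Lp

variable [Finite ι] (p : ℝ≥0) [hp : Fact (1 ≤ (p : ℝ≥0∞))]

variable (𝕜) in
/-- `stepFun` with values in `L¹ ∩ L^∞`. -/
noncomputable def stepL1Linf : (ι → 𝕜) →ₗ[𝕜] L1Linf 𝕜 m where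
  toFun c := ⟨(A.memLp_stepFun c 1).toLp _,
    (A.memLp_stepFun c ∞).ae_eq (A.memLp_stepFun c 1).coeFn_toLp.symm⟩
  map_add' c d := Subtype.ext <| by
    rw [Submodule.coe_add, ← MemLp.toLp_add, MemLp.toLp_eq_toLp_iff]
    exact .of_forall fun x => congrFun (indicator_add A.region (c ∘ A.index) (d ∘ A.index)) x
  map_smul' a c := Subtype.ext <| by
    rw [Submodule.coe_smul, ← MemLp.toLp_const_smul, MemLp.toLp_eq_toLp_iff]
    exact .of_forall fun x => congrFun (indicator_const_smul A.region a (c ∘ A.index)) x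

variable (𝕜) in
/-- `stepFun` with values in `L^p`. -/
noncomputable def stepLp : (ι → 𝕜) →ₗ[𝕜] Lp 𝕜 p m := inclLp 𝕜 m p ∘ₗ A.stepL1Linf 𝕜

variable (𝕜) in
/-- `mean` as a linear map on `L^p`. -/
noncomputable def meanLp : Lp 𝕜 p m →ₗ[𝕜] (ι → 𝕜) where
  toFun f := A.mean f
  map_add' f g := by
    have hint : ∀ (h : Lp 𝕜 p m) (i : ι), IntegrableOn h (A.cell i) m := fun h i =>
      ((Lp.memLp h).restrict _).integrable hp.out
    ext i
    rw [A.mean_congr_ae (Lp.coeFn_add f g)]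
    simp only [mean, setAverage_eq, Pi.add_apply, integral_add (hint f i) (hint g i), smul_add]
  map_smul' a f := by
    ext i
    rw [A.mean_congr_ae (Lp.coeFn_smul a f)]
    simp only [mean, setAverage_eq, Pi.smul_apply, RingHom.id_apply, integral_smul]
    exact smul_comm _ _ _

lemma coeFn_stepL1Linf (c : ι → 𝕜) : (A.stepL1Linf 𝕜 c).1 =ᵐ[m] A.stepFun c :=
  (A.memLp_stepFun c 1).coeFn_toLp

lemma coeFn_stepLp (c : ι → 𝕜) : A.stepLp 𝕜 p c =ᵐ[m] A.stepFun c :=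
  (coeFn_inclLp p _).trans (A.coeFn_stepL1Linf c)

lemma norm_stepLp_meanLp_le (f : Lp 𝕜 p m) : ‖A.stepLp 𝕜 p (A.meanLp 𝕜 p f)‖ ≤ ‖f‖ := by
  rw [Lp.norm_def, Lp.norm_def, eLpNorm_congr_ae (A.coeFn_stepLp p _), A.eLpNorm_stepFun]
  exact ENNReal.toReal_mono (Lp.eLpNorm_ne_top f)
    (A.eLpNorm_mean_le hp.out ENNReal.coe_ne_top (Lp.aestronglyMeasurable f))

lemma stepLp_meanLp_of_ae_eq_stepFun {f : Lp 𝕜 p m} {c : ι → 𝕜} (hf : f =ᵐ[m] A.stepFun c) :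
    A.stepLp 𝕜 p (A.meanLp 𝕜 p f) = f :=
  Lp.ext <| (A.coeFn_stepLp p _).trans <| ((A.stepFun_congr_ae <|
    (Filter.EventuallyEq.of_eq (A.mean_congr_ae hf)).trans (A.mean_stepFun_ae_eq c))).trans hf.symm

lemma norm_stepLp_meanLp_sub_le {f s : Lp 𝕜 p m} {c : ι → 𝕜} (hs : s =ᵐ[m] A.stepFun c) :
    ‖A.stepLp 𝕜 p (A.meanLp 𝕜 p f) - f‖ ≤ 2 * ‖f - s‖ :=
  calc ‖A.stepLp 𝕜 p (A.meanLp 𝕜 p f) - f‖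
      = ‖A.stepLp 𝕜 p (A.meanLp 𝕜 p (f - s)) - (f - s)‖ := by
        rw [map_sub, map_sub, A.stepLp_meanLp_of_ae_eq_stepFun p hs, sub_sub_sub_cancel_right]
    _ ≤ ‖f - s‖ + ‖f - s‖ := (norm_sub_le _ _).trans (by gcongr; exact A.norm_stepLp_meanLp_le p _)
    _ = 2 * ‖f - s‖ := (two_mul _).symm

end Lp

end FinitePartition

lemma exists_finitePartition_eq_stepFun {m : Measure Ω} {r : Type*} [Finite r]
    (σ : r → SimpleFunc Ω 𝕜) (hσ : ∀ k, m (Function.support (σ k)) ≠ ∞) :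
    ∃ (d : ℕ) (A : FinitePartition m (Fin d)), ∀ k, ∃ c : Fin d → 𝕜, ⇑(σ k) = A.stepFun c := by
  have hfinite : (range fun x k => σ k x).Finite :=
    (Finite.pi' fun k => (σ k).finite_range).subset (range_subset_iff.2 fun x k => mem_range_self x)
  have := hfinite.to_subtype
  let e := Finite.equivFin (range fun x k => σ k x)
  let A : FinitePartition m (Fin (Nat.card (range fun x k => σ k x))) :=
    { region := ⋃ k, Function.support (σ k)
      measurableSet_region := .iUnion fun k => (σ k).measurableSet_support
      measure_region_ne_top := by
        simpa using (measure_biUnion_lt_top finite_univ fun k _ => (hσ k).lt_top).ne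
      index := fun x => e ⟨_, mem_range_self x⟩
      measurable_index := measurable_to_countable' fun i => by
        have hfiber : (fun x => e ⟨_, mem_range_self x⟩) ⁻¹' {i} =
            ⋂ k, σ k ⁻¹' {(e.symm i).1 k} := by
          ext x
          rw [mem_preimage, mem_singleton_iff, ← Equiv.eq_symm_apply, Subtype.ext_iff, funext_iff]
          simp
        exact hfiber ▸ .iInter fun k => (σ k).measurableSet_fiber _ }
  refine ⟨_, A, fun k => ⟨fun i => (e.symm i).1 k, funext fun x => ?_⟩⟩
  by_cases hx : x ∈ A.region
  · rw [FinitePartition.stepFun, indicator_of_mem hx]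
    exact congrFun (congrArg Subtype.val (e.symm_apply_apply ⟨_, mem_range_self x⟩)).symm k
  · rw [FinitePartition.stepFun, indicator_of_notMem hx]
    exact Function.notMem_support.1 fun hk => hx (mem_iUnion_of_mem k hk)

lemma exists_finitePartition_norm_stepLp_meanLp_sub_le {m : Measure Ω} {p : ℝ≥0}
    [hp : Fact (1 ≤ (p : ℝ≥0∞))] {r : Type*} [Finite r] (g : r → Lp 𝕜 p m) {ε : ℝ} (hε : 0 < ε) :
    ∃ (d : ℕ) (A : FinitePartition m (Fin d)),
      ∀ k, ‖A.stepLp 𝕜 p (A.meanLp 𝕜 p (g k)) - g k‖ ≤ ε := by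
  have hp0 : (p : ℝ≥0∞) ≠ 0 := (zero_lt_one.trans_le hp.out).ne'
  choose s hs using fun k => (Lp.simpleFunc.denseRange (E := 𝕜) (μ := m) (p := p)
    ENNReal.coe_ne_top).exists_dist_lt (g k) (half_pos hε)
  obtain ⟨d, A, hA⟩ := exists_finitePartition_eq_stepFun (m := m)
    (fun k => Lp.simpleFunc.toSimpleFunc (s k)) fun k =>
      (SimpleFunc.measure_support_lt_top_of_memLp _ (Lp.simpleFunc.memLp (s k)) hp0
        ENNReal.coe_ne_top).ne
  refine ⟨d, A, fun k => ?_⟩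
  obtain ⟨c, hc⟩ := hA k
  have hstep : (s k : Lp 𝕜 p m) =ᵐ[m] A.stepFun c :=
    (Lp.simpleFunc.toSimpleFunc_eq_toFun (s k)).symm.trans (.of_eq hc)
  calc _ ≤ 2 * ‖g k - s k‖ := A.norm_stepLp_meanLp_sub_le p hstep
    _ ≤ ε := by linarith [hs k, dist_eq_norm (g k) (s k)]

end FinitePartition

/-! ### Dunford–Schwartz operators -/

section AbsMatrix

open Matrix

variable {𝕜 : Type*} [RCLike 𝕜] {ι : Type*} [Fintype ι] [DecidableEq ι]

/-- The matrix of `L` with each entry replaced by its absolute value; it dominates `L` pointwise. -/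
noncomputable def absMatrix (L : (ι → 𝕜) →ₗ[𝕜] (ι → 𝕜)) : Matrix ι ι ℝ≥0 :=
  L.toMatrix'.map (‖·‖₊)

lemma nnnorm_apply_le_absMatrix_mulVec (L : (ι → 𝕜) →ₗ[𝕜] (ι → 𝕜)) (c : ι → 𝕜) (i : ι) :
    ‖L c i‖₊ ≤ (absMatrix L *ᵥ fun j => ‖c j‖₊) i := by
  rw [← LinearMap.toMatrix'_mulVec L c]
  exact (nnnorm_sum_le _ _).trans_eq (by simp [absMatrix, mulVec, dotProduct, nnnorm_mul])

lemma nnnorm_iterate_le_absMatrix_pow_mulVec (L : (ι → 𝕜) →ₗ[𝕜] (ι → 𝕜)) (k : ℕ) (c : ι → 𝕜)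
    (i : ι) : ‖L^[k] c i‖₊ ≤ ((absMatrix L ^ k) *ᵥ fun j => ‖c j‖₊) i := by
  induction k generalizing i with
  | zero => simp
  | succ k ih =>
    rw [Function.iterate_succ_apply', pow_succ', ← mulVec_mulVec]
    exact (nnnorm_apply_le_absMatrix_mulVec L _ i).trans
      (Finset.sum_le_sum fun j _ => mul_le_mul_right (ih j) _)

lemma nnnorm_birkhoffAverage_le_powerAverage_mulVec (L : (ι → 𝕜) →ₗ[𝕜] (ι → 𝕜)) (k : ℕ)
    (c : ι → 𝕜) (i : ι) :
    ‖birkhoffAverage ℝ L _root_.id (k + 1) c i‖₊ ≤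
      (powerAverage (absMatrix L) k *ᵥ fun j => ‖c j‖₊) i := by
  simp only [birkhoffAverage, birkhoffSum, powerAverage, _root_.id, Pi.smul_apply, smul_mulVec,
    sum_mulVec, Finset.sum_apply, nnnorm_smul, smul_eq_mul]
  gcongr
  · rw [nnnorm_inv, Real.nnnorm_natCast, Nat.cast_succ]
  · exact (nnnorm_sum_le _ _).trans
      (Finset.sum_le_sum fun k _ => nnnorm_iterate_le_absMatrix_pow_mulVec L k c i)

lemma sum_absMatrix_le_one {L : (ι → 𝕜) →ₗ[𝕜] (ι → 𝕜)} (hL : ∀ c, ‖L c‖ ≤ ‖c‖) (i : ι) :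
    ∑ j, absMatrix L i j ≤ 1 := by
  choose c hc hcL using fun j => RCLike.exists_norm_eq_mul_self (L.toMatrix' i j)
  have hsum : (((∑ j, absMatrix L i j : ℝ≥0) : ℝ) : 𝕜) = L c i := by
    rw [← LinearMap.toMatrix'_mulVec L c]
    simp only [absMatrix, Matrix.map_apply, mulVec, dotProduct, NNReal.coe_sum, coe_nnnorm,
      RCLike.ofReal_sum, hcL, mul_comm]
  have hc1 : ‖c‖ ≤ 1 := (pi_norm_le_iff_of_nonneg zero_le_one).2 fun j => (hc j).le
  calc ((∑ j, absMatrix L i j : ℝ≥0) : ℝ) = ‖L c i‖ := by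
        rw [← hsum, RCLike.norm_ofReal, abs_of_nonneg (NNReal.coe_nonneg _)]
    _ ≤ 1 := (norm_le_pi_norm _ _).trans ((hL c).trans hc1)

lemma isSubstochastic_absMatrix [MeasurableSpace ι] [DiscreteMeasurableSpace ι] {μ : Measure ι}
    {L : (ι → 𝕜) →ₗ[𝕜] (ι → 𝕜)} (h_one : ∀ c, eLpNorm (L c) 1 μ ≤ eLpNorm c 1 μ)
    (h_top : ∀ c, ‖L c‖ ≤ ‖c‖) : IsSubstochastic μ (absMatrix L) where
  row_sum_le_one := sum_absMatrix_le_one h_top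
  sum_mul_measure_le j := by
    have h := h_one (Pi.single j 1)
    have hsingle : ∑ i, ‖(Pi.single j 1 : ι → 𝕜) i‖ₑ * μ {i} = μ {j} := by
      rw [Finset.sum_eq_single_of_mem j (Finset.mem_univ j) (by simp +contextual)]
      simp
    simp only [eLpNorm_one_eq_lintegral_enorm, lintegral_fintype, hsingle] at h
    refine le_of_eq_of_le (Finset.sum_congr rfl fun i _ => ?_) h
    rw [absMatrix, Matrix.map_apply, LinearMap.toMatrix'_apply, enorm_eq_nnnorm]

end AbsMatrix

section Operators

variable {𝕜 : Type*} [RCLike 𝕜] {Ω : Type*} [MeasurableSpace Ω] {m : Measure Ω}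
  {p : ℝ≥0} [hp : Fact (1 ≤ (p : ℝ≥0∞))] {κ : Type*} {s : Finset κ}

section Stability

variable {τ : Type*} {t : Finset τ} {q : ℝ}

lemma mixedNorm_finsetSum_le {p : ℝ} (hp : 1 ≤ p) (hq : 1 ≤ q) {g : τ → κ → Ω → ℝ≥0∞}
    (hg : ∀ k ∈ t, ∀ n ∈ s, AEMeasurable (g k n) m) :
    mixedNorm p q m s (∑ k ∈ t, g k) ≤ ∑ k ∈ t, mixedNorm p q m s (g k) := by
  induction t using Finset.cons_induction with
  | empty => simp [mixedNorm, zero_lt_one.trans_le hp, zero_lt_one.trans_le hq]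
  | cons a t ha ih =>
    rw [Finset.forall_mem_cons] at hg
    rw [Finset.sum_cons, Finset.sum_cons]
    refine (mixedNorm_add_le hp hq hg.1 fun n hn => ?_).trans (by gcongr; exact ih hg.2)
    rw [Finset.sum_apply]
    exact Finset.aemeasurable_sum t fun k hk => hg.2 k hk n hn

lemma lintegral_enorm_rpow_rpow_eq_enorm (f : Lp 𝕜 p m) :
    (∫⁻ x, ‖f x‖ₑ ^ (p : ℝ) ∂m) ^ (1 / (p : ℝ)) = ‖f‖ₑ := by
  rw [Lp.enorm_def, eLpNorm_eq_lintegral_rpow_enorm_toReal (zero_lt_one.trans_le hp.out).ne'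
    ENNReal.coe_ne_top, ENNReal.coe_toReal]

lemma mixedNorm_sup_enorm_le (hq : 1 ≤ q) (f g : κ → τ → Lp 𝕜 p m) :
    mixedNorm p q m s (fun n x => t.sup fun k => ‖f n k x‖ₑ) ≤
      mixedNorm p q m s (fun n x => t.sup fun k => ‖g n k x‖ₑ) +
        ∑ k ∈ t, ∑ n ∈ s, ‖f n k - g n k‖ₑ := by
  have hp1 : (1 : ℝ) ≤ p := mod_cast hp.out
  have hmeas : ∀ f : Lp 𝕜 p m, AEMeasurable (fun x => ‖f x‖ₑ) m := fun f =>
    (Lp.aestronglyMeasurable f).enorm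
  have hpointwise : ∀ n ∈ s, (fun x => t.sup fun k => ‖f n k x‖ₑ) ≤ᵐ[m]
      ((fun n x => t.sup fun k => ‖g n k x‖ₑ) + ∑ k ∈ t, fun n x => ‖(f n k - g n k) x‖ₑ) n := by
    intro n _
    filter_upwards [(Finset.eventually_all t).2 fun k _ => Lp.coeFn_sub (f n k) (g n k)] with x hx
    simp only [Pi.add_apply, Finset.sum_apply]
    refine Finset.sup_le fun k hk => ?_
    calc ‖f n k x‖ₑ
        = ‖g n k x + (f n k - g n k) x‖ₑ := by rw [hx k hk, Pi.sub_apply, add_sub_cancel]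
      _ ≤ ‖g n k x‖ₑ + ‖(f n k - g n k) x‖ₑ := enorm_add_le _ _
      _ ≤ _ := add_le_add (Finset.le_sup (f := fun k => ‖g n k x‖ₑ) hk)
        (Finset.single_le_sum (f := fun k => ‖(f n k - g n k) x‖ₑ) (fun _ _ => zero_le) hk)
  refine (mixedNorm_mono_ae (by linarith) (by linarith) hpointwise).trans
    ((mixedNorm_add_le hp1 hq (fun n _ => ?_) fun n _ => ?_).trans (add_le_add le_rfl ?_))
  · simp only [Finset.sup_eq_iSup]
    exact .biSup _ t.countable_toSet fun k _ => hmeas _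
  · rw [Finset.sum_apply]
    exact Finset.aemeasurable_sum t fun k _ => hmeas _
  · refine (mixedNorm_finsetSum_le hp1 hq fun k _ n _ => hmeas _).trans
      (Finset.sum_le_sum fun k _ => (mixedNorm_le_sum hp1 hq fun n _ => hmeas _).trans_eq ?_)
    simp only [lintegral_enorm_rpow_rpow_eq_enorm]

lemma tendsto_mixedNorm_sup_enorm {β : Type*} {l : Filter β} (hq : 1 ≤ q)
    {g : β → κ → τ → Lp 𝕜 p m} {f : κ → τ → Lp 𝕜 p m}
    (h : ∀ n ∈ s, ∀ k ∈ t, Tendsto (fun j => g j n k) l (𝓝 (f n k))) :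
    Tendsto (fun j => mixedNorm p q m s fun n x => t.sup fun k => ‖g j n k x‖ₑ) l
      (𝓝 (mixedNorm p q m s fun n x => t.sup fun k => ‖f n k x‖ₑ)) := by
  have herror : Tendsto (fun j => ∑ k ∈ t, ∑ n ∈ s, ‖g j n k - f n k‖ₑ) l (𝓝 0) := by
    rw [← Finset.sum_const_zero (s := t), ← Finset.sum_const_zero (s := s)]
    exact tendsto_finsetSum t fun k hk => tendsto_finsetSum s fun n hn =>
      (tendsto_iff_enorm_sub_tendsto_zero.1 (h n hn k hk))
  refine tendsto_of_tendsto_of_tendsto_of_le_of_le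
    (by simpa using ENNReal.Tendsto.sub tendsto_const_nhds herror (Or.inr ENNReal.zero_ne_top))
    (by simpa using tendsto_const_nhds.add herror) (fun j => tsub_le_iff_right.2 ?_)
    (fun j => mixedNorm_sup_enorm_le hq _ _)
  simpa only [enorm_sub_rev] using mixedNorm_sup_enorm_le (s := s) (t := t) hq f (g j)

lemma tendsto_mixedNorm_enorm {β : Type*} {l : Filter β} (hq : 1 ≤ q) {g : β → κ → Lp 𝕜 p m}
    {f : κ → Lp 𝕜 p m} (h : ∀ n ∈ s, Tendsto (fun j => g j n) l (𝓝 (f n))) :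
    Tendsto (fun j => mixedNorm p q m s fun n x => ‖g j n x‖ₑ) l
      (𝓝 (mixedNorm p q m s fun n x => ‖f n x‖ₑ)) := by
  have hsup := tendsto_mixedNorm_sup_enorm (t := {()}) hq (g := fun j n _ => g j n)
    (f := fun n _ => f n) fun n hn _ _ => h n hn
  simpa only [Finset.sup_singleton] using hsup

end Stability

/-- `U` is a Dunford–Schwartz operator: on `L¹ ∩ L^∞` it contracts both the norm of `L¹` and the
norm of `L^∞`. -/
structure IsDunfordSchwartz (U : Lp 𝕜 p m →L[𝕜] Lp 𝕜 p m) : Prop where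
  eLpNorm_one_le : ∀ g : L1Linf 𝕜 m, eLpNorm (U (inclLp 𝕜 m p g)) 1 m ≤ eLpNorm g.1 1 m
  eLpNorm_top_le : ∀ g : L1Linf 𝕜 m, eLpNorm (U (inclLp 𝕜 m p g)) ∞ m ≤ eLpNorm g.1 ∞ m

namespace FinitePartition

variable {ι : Type*} [MeasurableSpace ι] [DiscreteMeasurableSpace ι]

/-- The operator `U` seen through the partition: extend by a step function, apply `U`, and take
the means over the cells. -/
noncomputable def compression [Finite ι] (A : FinitePartition m ι)
    (U : Lp 𝕜 p m →L[𝕜] Lp 𝕜 p m) : (ι → 𝕜) →ₗ[𝕜] (ι → 𝕜) :=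
  A.meanLp 𝕜 p ∘ₗ U.toLinearMap ∘ₗ A.stepLp 𝕜 p

lemma tendsto_stepLp_compression_iterate {β : Type*} {l : Filter β} {ι : β → Type*}
    [∀ j, MeasurableSpace (ι j)] [∀ j, DiscreteMeasurableSpace (ι j)] [∀ j, Finite (ι j)]
    (A : ∀ j, FinitePartition m (ι j)) (U : Lp 𝕜 p m →L[𝕜] Lp 𝕜 p m) (f : Lp 𝕜 p m)
    (hA : ∀ k, Tendsto (fun j => (A j).stepLp 𝕜 p ((A j).meanLp 𝕜 p (U^[k] f))) l (𝓝 (U^[k] f)))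
    (k : ℕ) :
    Tendsto (fun j => (A j).stepLp 𝕜 p (((A j).compression U)^[k] ((A j).meanLp 𝕜 p f))) l
      (𝓝 (U^[k] f)) := by
  induction k with
  | zero => exact hA 0
  | succ k ih =>
    set g : β → Lp 𝕜 p m := fun j =>
      (A j).stepLp 𝕜 p (((A j).compression U)^[k] ((A j).meanLp 𝕜 p f))
    have herror : Tendsto (fun j => (A j).stepLp 𝕜 p ((A j).meanLp 𝕜 p (U (g j - U^[k] f)))) l
        (𝓝 0) := by
      have hU : Tendsto (fun j => U (g j - U^[k] f)) l (𝓝 0) := by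
        simpa only [sub_self, map_zero, Function.comp_def] using
          (U.continuous.tendsto _).comp (ih.sub_const (U^[k] f))
      exact squeeze_zero_norm (fun j => (A j).norm_stepLp_meanLp_le p _)
        (tendsto_zero_iff_norm_tendsto_zero.1 hU)
    have hsplit : (fun j => (A j).stepLp 𝕜 p
        (((A j).compression U)^[k + 1] ((A j).meanLp 𝕜 p f))) =
        fun j => (A j).stepLp 𝕜 p ((A j).meanLp 𝕜 p (U (g j - U^[k] f))) +
          (A j).stepLp 𝕜 p ((A j).meanLp 𝕜 p (U^[k + 1] f)) := by
      funext j
      rw [Function.iterate_succ_apply', Function.iterate_succ_apply', map_sub, map_sub, map_sub,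
        sub_add_cancel]
      rfl
    rw [hsplit]
    simpa only [zero_add] using herror.add (hA (k + 1))

lemma tendsto_stepLp_birkhoffAverage {β : Type*} {l : Filter β} {ι : β → Type*}
    [∀ j, MeasurableSpace (ι j)] [∀ j, DiscreteMeasurableSpace (ι j)] [∀ j, Finite (ι j)]
    (A : ∀ j, FinitePartition m (ι j)) (U : Lp 𝕜 p m →L[𝕜] Lp 𝕜 p m) (f : Lp 𝕜 p m)
    (hA : ∀ k, Tendsto (fun j => (A j).stepLp 𝕜 p ((A j).meanLp 𝕜 p (U^[k] f))) l (𝓝 (U^[k] f)))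
    (k : ℕ) :
    Tendsto (fun j => (A j).stepLp 𝕜 p
      (birkhoffAverage ℝ ((A j).compression U) _root_.id k ((A j).meanLp 𝕜 p f))) l
      (𝓝 (birkhoffAverage ℝ U _root_.id k f)) := by
  simp only [map_birkhoffAverage ℝ ℝ]
  exact (tendsto_finsetSum _ fun i _ =>
    tendsto_stepLp_compression_iterate A U f hA i).const_smul _

variable (A : FinitePartition m ι) {U : Lp 𝕜 p m →L[𝕜] Lp 𝕜 p m}

lemma isSubstochastic_absMatrix_compression [Fintype ι] [DecidableEq ι]
    (hU : IsDunfordSchwartz U) :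
    IsSubstochastic A.weight (absMatrix (A.compression U)) := by
  have hmeas := fun c => Lp.aestronglyMeasurable (U (A.stepLp 𝕜 p c))
  refine isSubstochastic_absMatrix (fun c => ?_) fun c =>
    (pi_norm_le_iff_of_nonneg (norm_nonneg c)).2 fun i => ?_
  · calc eLpNorm (A.mean (U (A.stepLp 𝕜 p c))) 1 A.weight
        ≤ eLpNorm (U (A.stepLp 𝕜 p c)) 1 m := A.eLpNorm_mean_le le_rfl ENNReal.one_ne_top (hmeas c)
      _ ≤ eLpNorm (A.stepL1Linf 𝕜 c).1 1 m := hU.eLpNorm_one_le _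
      _ = eLpNorm c 1 A.weight := by
        rw [eLpNorm_congr_ae (A.coeFn_stepL1Linf c), A.eLpNorm_stepFun]
  · rw [← enorm_le_iff_norm_le]
    calc ‖A.mean (U (A.stepLp 𝕜 p c)) i‖ₑ
        ≤ eLpNorm (U (A.stepLp 𝕜 p c)) ∞ m := A.enorm_mean_le_eLpNorm_top (hmeas c) i
      _ ≤ eLpNorm (A.stepL1Linf 𝕜 c).1 ∞ m := hU.eLpNorm_top_le _
      _ = eLpNorm c ∞ A.weight := by
        rw [eLpNorm_congr_ae (A.coeFn_stepL1Linf c), A.eLpNorm_stepFun]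
      _ ≤ ‖c‖ₑ := eLpNormEssSup_le_of_ae_nnnorm_bound (.of_forall fun j => nnnorm_le_pi_nnnorm c j)

lemma mixedNorm_stepLp_birkhoffAverage_le [Finite ι] {q : ℝ≥0} (hU : IsDunfordSchwartz U)
    (hp1 : 1 < p) (hpq : p ≤ q) (c : κ → ι → 𝕜) (K : ℕ) :
    mixedNorm p q m s (fun n x => (Finset.range K).sup fun k =>
        ‖A.stepLp 𝕜 p (birkhoffAverage ℝ (A.compression U) _root_.id (k + 1) (c n)) x‖ₑ) ≤
      ENNReal.ofReal (p / (p - 1)) * mixedNorm p q m s (fun n x => ‖A.stepLp 𝕜 p (c n) x‖ₑ) := by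
  classical
  have := Fintype.ofFinite ι
  have hp0 : (0 : ℝ) < p := zero_lt_one.trans (NNReal.one_lt_coe.2 hp1)
  have hq0 : (0 : ℝ) < q := hp0.trans_le (NNReal.coe_le_coe.2 hpq)
  have henorm : ∀ c : ι → 𝕜, (fun x => ‖A.stepLp 𝕜 p c x‖ₑ) =ᵐ[m]
      A.stepFun fun i => (‖c i‖₊ : ℝ≥0∞) := fun c => by
    filter_upwards [A.coeFn_stepLp p c] with x hx
    rw [hx]
    exact A.map_stepFun enorm_zero c x
  set b := absMatrix (A.compression U)
  have hpointwise : ∀ n ∈ s, (fun x => (Finset.range K).sup fun k =>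
      ‖A.stepLp 𝕜 p (birkhoffAverage ℝ (A.compression U) _root_.id (k + 1) (c n)) x‖ₑ) ≤ᵐ[m]
      A.stepFun fun i => (maximalAverage b K (fun j => ‖c n j‖₊) i : ℝ≥0∞) := by
    intro n _
    filter_upwards [(Finset.eventually_all (Finset.range K)).2 fun k _ => henorm
      (birkhoffAverage ℝ (A.compression U) _root_.id (k + 1) (c n))] with x hx
    refine Finset.sup_le fun k hk => (hx k hk).trans_le (indicator_le_indicator ?_)
    exact ENNReal.coe_le_coe.2 <| (nnnorm_birkhoffAverage_le_powerAverage_mulVec _ k _ _).trans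
      (powerAverage_mulVec_le_maximalAverage b (Finset.mem_range.1 hk) _ _)
  calc _ ≤ mixedNorm p q m s fun n =>
          A.stepFun fun i => (maximalAverage b K (fun j => ‖c n j‖₊) i : ℝ≥0∞) :=
        mixedNorm_mono_ae hp0 hq0 hpointwise
    _ ≤ ENNReal.ofReal (p / (p - 1)) *
          mixedNorm p q m s fun n => A.stepFun fun i => (‖c n i‖₊ : ℝ≥0∞) := by
        rw [A.mixedNorm_stepFun hp0 hq0, A.mixedNorm_stepFun hp0 hq0]
        exact (A.isSubstochastic_absMatrix_compression hU).mixedNorm_maximalAverage_le K hp1 hpq _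
    _ = _ := by rw [mixedNorm_congr_ae fun n _ => henorm (c n)]

end FinitePartition

lemma exists_finitePartition_tendsto_stepLp_meanLp {r : Type*} [Countable r] (g : r → Lp 𝕜 p m) :
    ∃ (d : ℕ → ℕ) (A : ∀ j, FinitePartition m (Fin (d j))), ∀ k,
      Tendsto (fun j => (A j).stepLp 𝕜 p ((A j).meanLp 𝕜 p (g k))) atTop (𝓝 (g k)) := by
  obtain ⟨φ, hφ⟩ := exists_injective_nat r
  have hfinite : ∀ j : ℕ, Finite {k // φ k < j} := fun j =>
    ((finite_lt_nat j).preimage hφ.injOn).to_subtype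
  choose d A hA using fun j : ℕ => exists_finitePartition_norm_stepLp_meanLp_sub_le
    (fun k : {k // φ k < j} => g k) (Nat.one_div_pos_of_nat (α := ℝ) (n := j))
  refine ⟨d, A, fun k => tendsto_iff_norm_sub_tendsto_zero.2 <|
    squeeze_zero' (.of_forall fun j => norm_nonneg _) ?_ tendsto_one_div_add_atTop_nhds_zero_nat⟩
  filter_upwards [eventually_gt_atTop (φ k)] with j hj using hA j ⟨k, hj⟩

theorem IsDunfordSchwartz.mixedNorm_birkhoffAverage_le {q : ℝ≥0} {U : Lp 𝕜 p m →L[𝕜] Lp 𝕜 p m}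
    (hU : IsDunfordSchwartz U) (hp1 : 1 < p) (hpq : p ≤ q) (f : κ → Lp 𝕜 p m) (K : ℕ) :
    mixedNorm p q m s (fun n x => (Finset.range K).sup fun k =>
        ‖birkhoffAverage ℝ U _root_.id (k + 1) (f n) x‖ₑ) ≤
      ENNReal.ofReal (p / (p - 1)) * mixedNorm p q m s (fun n x => ‖f n x‖ₑ) := by
  have hq : (1 : ℝ) ≤ q := NNReal.one_le_coe.2 (hp1.le.trans hpq)
  obtain ⟨d, A, hA⟩ := exists_finitePartition_tendsto_stepLp_meanLp (𝕜 := 𝕜) (m := m) (p := p)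
    fun z : s × ℕ => U^[z.2] (f z.1)
  have hleft := tendsto_mixedNorm_sup_enorm (s := s) (t := Finset.range K) hq fun n hn k _ =>
    FinitePartition.tendsto_stepLp_birkhoffAverage A U (f n) (fun k => hA (⟨n, hn⟩, k)) (k + 1)
  have hright := tendsto_mixedNorm_enorm (s := s) hq (f := f)
    (g := fun j n => (A j).stepLp 𝕜 p ((A j).meanLp 𝕜 p (f n))) fun n hn => hA (⟨n, hn⟩, 0)
  exact le_of_tendsto_of_tendsto' hleft
    (ENNReal.Tendsto.const_mul hright (Or.inr ENNReal.ofReal_ne_top))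
    (fun j => (A j).mixedNorm_stepLp_birkhoffAverage_le hU hp1 hpq _ K)

end Operators

/-! ### The semigroup on `L^p` -/

section Semigroup

variable {𝕜 : Type*} [RCLike 𝕜] {Ω : Type*} [MeasurableSpace Ω] {m : Measure Ω}

lemma eLpNorm_le_eLpNorm_one_mul_eLpNorm_top_rpow {E : Type*} [NormedAddCommGroup E] {p : ℝ≥0}
    (hp : 1 ≤ p) {f : Ω → E} (hf : AEStronglyMeasurable f m) :
    eLpNorm f p m ≤ (eLpNorm f 1 m * eLpNorm f ∞ m ^ (p - 1 : ℝ)) ^ (p⁻¹ : ℝ) := by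
  have hp1 : (0 : ℝ) ≤ p - 1 := sub_nonneg.2 (NNReal.one_le_coe.2 hp)
  have hp0 : 0 < p := zero_lt_one.trans_le hp
  rw [ENNReal.le_rpow_inv_iff (mod_cast hp0), eLpNorm_nnreal_pow_eq_lintegral hp0.ne',
    eLpNorm_one_eq_lintegral_enorm, ← lintegral_mul_const'' _ hf.enorm]
  refine lintegral_mono_ae ?_
  filter_upwards [enorm_ae_le_eLpNormEssSup f m] with x hx
  calc ‖f x‖ₑ ^ (p : ℝ) = ‖f x‖ₑ * ‖f x‖ₑ ^ (p - 1 : ℝ) := by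
        rw [← add_sub_cancel 1 (p : ℝ), ENNReal.rpow_add_of_nonneg _ _ zero_le_one hp1,
          ENNReal.rpow_one, add_sub_cancel]
    _ ≤ ‖f x‖ₑ * eLpNorm f ∞ m ^ (p - 1 : ℝ) := by
        rw [eLpNorm_exponent_top]
        gcongr

variable {p : ℝ≥0} [hp : Fact (1 ≤ (p : ℝ≥0∞))]

lemma ext_inclLp {U V : Lp 𝕜 p m →L[𝕜] Lp 𝕜 p m}
    (h : ∀ g, U (inclLp 𝕜 m p g) = V (inclLp 𝕜 m p g)) : U = V :=
  DFunLike.coe_injective <|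
    (denseRange_inclLp p).equalizer U.continuous V.continuous (funext h)

namespace ContractionSemigroup

variable (S : ContractionSemigroup 𝕜 m)

lemma isDunfordSchwartz_onLp (t : ℝ≥0) : IsDunfordSchwartz (S.onLp p t) where
  eLpNorm_one_le g := by
    rw [onLp_inclLp, eLpNorm_congr_ae (coeFn_inclLp p _)]
    exact S.contraction_one t g.1
  eLpNorm_top_le g := by
    rw [onLp_inclLp, eLpNorm_congr_ae (coeFn_inclLp p _)]
    exact S.contraction_top t g.1

variable (p) in
lemma exists_forall_norm_onLp_le : ∃ K : ℝ≥0, ∀ t f, ‖S.onLp p t f‖ ≤ K * ‖f‖ := by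
  have hp1 : 1 ≤ p := mod_cast hp.out
  obtain ⟨K, hK⟩ : ∃ K : ℝ≥0, ∀ t, ∀ g : L1Linf 𝕜 m,
      eLpNorm (S.T t g.1) p m ≤ K * eLpNorm g.1 p m := by
    rcases hp1.eq_or_lt with rfl | hp1
    · exact ⟨1, fun t g => by simpa using S.contraction_one t g.1⟩
    · have hp0 : p ≠ 0 := (zero_lt_one.trans hp1).ne'
      refine ⟨(p * 2 ^ (p : ℝ) / (p - 1) : ℝ).toNNReal ^ (p⁻¹ : ℝ), fun t g => ?_⟩
      rw [eLpNorm_nnreal_eq_lintegral hp0, eLpNorm_nnreal_eq_lintegral hp0, one_div,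
        ENNReal.coe_rpow_of_nonneg _ (by positivity),
        ← ENNReal.mul_rpow_of_nonneg _ _ (by positivity)]
      gcongr
      exact S.lintegral_rpow_le t g.1 (NNReal.one_lt_coe.2 hp1)
  refine ⟨K, fun t f => (denseRange_inclLp p).induction_on f
    (isClosed_le (by fun_prop) (by fun_prop)) fun g => ?_⟩
  have henorm : ‖inclLp 𝕜 m p (S.onL1Linf t g)‖ₑ ≤ K * ‖inclLp 𝕜 m p g‖ₑ := by
    rw [Lp.enorm_def, Lp.enorm_def, eLpNorm_congr_ae (coeFn_inclLp p _),
      eLpNorm_congr_ae (coeFn_inclLp p g)]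
    exact hK t g
  rw [enorm_eq_nnnorm, enorm_eq_nnnorm] at henorm
  rw [onLp_inclLp]
  exact_mod_cast henorm

lemma onLp_zero : S.onLp p 0 = ContinuousLinearMap.id 𝕜 (Lp 𝕜 p m) := by
  refine ext_inclLp fun g => ?_
  have hg : S.onL1Linf 0 g = g := Subtype.ext (DFunLike.congr_fun S.map_zero g.1)
  rw [onLp_inclLp, hg, ContinuousLinearMap.id_apply]

lemma onLp_add (s t : ℝ≥0) : S.onLp p (s + t) = S.onLp p s ∘L S.onLp p t := by
  refine ext_inclLp fun g => ?_
  have hg : S.onL1Linf (s + t) g = S.onL1Linf s (S.onL1Linf t g) :=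
    Subtype.ext (DFunLike.congr_fun (S.map_add s t) g.1)
  rw [ContinuousLinearMap.comp_apply, onLp_inclLp, onLp_inclLp, onLp_inclLp, hg]

lemma onLp_natCast_mul (k : ℕ) (t : ℝ≥0) : ⇑(S.onLp p (k * t)) = (S.onLp p t)^[k] := by
  induction k with
  | zero => simp [onLp_zero]
  | succ k ih =>
    rw [Nat.cast_succ, add_mul, one_mul, onLp_add, ContinuousLinearMap.coe_comp, ih,
      Function.iterate_succ]

lemma edist_onLp_inclLp_le (g : L1Linf 𝕜 m) (s t : ℝ≥0) :
    edist (S.onLp p s (inclLp 𝕜 m p g)) (S.onLp p t (inclLp 𝕜 m p g)) ≤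
      (edist (S.T s g.1) (S.T t g.1) * (2 * eLpNorm g.1 ∞ m) ^ (p - 1 : ℝ)) ^ (p⁻¹ : ℝ) := by
  have hp1 : 1 ≤ p := mod_cast hp.out
  have hmeas := fun t => Lp.aestronglyMeasurable (S.T t g.1)
  have htop : eLpNorm (S.T s g.1 - S.T t g.1 : Ω → 𝕜) ∞ m ≤ 2 * eLpNorm g.1 ∞ m :=
    calc _ ≤ eLpNorm (S.T s g.1) ∞ m + eLpNorm (S.T t g.1) ∞ m :=
          eLpNorm_sub_le (hmeas s) (hmeas t) le_top
      _ ≤ 2 * eLpNorm g.1 ∞ m :=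
          two_mul (eLpNorm g.1 ∞ m) ▸ add_le_add (S.contraction_top s _) (S.contraction_top t _)
  rw [onLp_inclLp, onLp_inclLp, Lp.edist_def, Lp.edist_def, eLpNorm_congr_ae <|
    (coeFn_inclLp p (S.onL1Linf s g)).sub (coeFn_inclLp p (S.onL1Linf t g))]
  refine (eLpNorm_le_eLpNorm_one_mul_eLpNorm_top_rpow hp1 ((hmeas s).sub (hmeas t))).trans ?_
  gcongr
  exact sub_nonneg.2 (NNReal.one_le_coe.2 hp1)

lemma continuous_onLp_inclLp (g : L1Linf 𝕜 m) :
    Continuous fun t : ℝ≥0 => S.onLp p t (inclLp 𝕜 m p g) := by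
  have hp1 : (1 : ℝ) ≤ p := mod_cast hp.out
  have htop : (2 * eLpNorm g.1 ∞ m) ^ (p - 1 : ℝ) ≠ ∞ := ENNReal.rpow_ne_top_of_nonneg
    (sub_nonneg.2 hp1) (ENNReal.mul_ne_top ENNReal.ofNat_ne_top g.2.eLpNorm_ne_top)
  refine continuous_iff_continuousAt.2 fun t => tendsto_iff_edist_tendsto_0.2 <|
    tendsto_of_tendsto_of_tendsto_of_le_of_le tendsto_const_nhds ?_ (fun _ => zero_le)
      fun s => S.edist_onLp_inclLp_le g s t
  have hone := tendsto_iff_edist_tendsto_0.1 ((S.continuous g.1).tendsto t)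
  have hmul := (ENNReal.Tendsto.mul_const hone (Or.inr htop)).ennrpow_const (p⁻¹ : ℝ)
  rwa [zero_mul, ENNReal.zero_rpow_of_pos (by positivity)] at hmul

theorem continuous_onLp (f : Lp 𝕜 p m) : Continuous fun t : ℝ≥0 => S.onLp p t f := by
  obtain ⟨K, hK⟩ := S.exists_forall_norm_onLp_le p
  refine continuous_of_uniform_approx_of_continuous fun u hu => ?_
  obtain ⟨ε, hε, hu⟩ := Metric.mem_uniformity_dist.1 hu
  obtain ⟨g, hg⟩ := (denseRange_inclLp p).exists_dist_lt f (ε := ε / (K + 1)) (by positivity)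
  refine ⟨_, S.continuous_onLp_inclLp g, fun t => hu ?_⟩
  rw [dist_eq_norm, lt_div_iff₀' (by positivity)] at hg
  rw [dist_eq_norm, ← map_sub]
  calc _ ≤ K * ‖f - inclLp 𝕜 m p g‖ := hK t _
    _ ≤ (K + 1) * ‖f - inclLp 𝕜 m p g‖ := by gcongr; exact le_add_of_nonneg_right zero_le_one
    _ < ε := hg

lemma continuous_onLp_toNNReal (f : Lp 𝕜 p m) :
    Continuous fun t : ℝ => S.onLp p t.toNNReal f :=
  (S.continuous_onLp f).comp continuous_real_toNNReal

lemma intervalIntegrable_onLp (f : Lp 𝕜 p m) (a b : ℝ) :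
    IntervalIntegrable (fun t : ℝ => S.onLp p t.toNNReal f) volume a b :=
  (S.continuous_onLp_toNNReal f).intervalIntegrable a b

lemma integral_onLp_add (f : Lp 𝕜 p m) (s t : ℝ≥0) :
    ∫ r in (s : ℝ)..(s + t : ℝ≥0), S.onLp p r.toNNReal f =
      S.onLp p s (∫ r in (0 : ℝ)..t, S.onLp p r.toNNReal f) := by
  rw [← ContinuousLinearMap.intervalIntegral_comp_comm _ (S.intervalIntegrable_onLp f _ _)]
  have htranslate := intervalIntegral.integral_comp_add_left (a := 0) (b := (t : ℝ))
    (fun r : ℝ => S.onLp p r.toNNReal f) s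
  rw [add_zero, ← NNReal.coe_add] at htranslate
  rw [← htranslate]
  refine intervalIntegral.integral_congr fun r hr => ?_
  rw [uIcc_of_le t.coe_nonneg] at hr
  simp only [Real.toNNReal_add s.coe_nonneg hr.1, Real.toNNReal_coe, onLp_add,
    ContinuousLinearMap.comp_apply]

lemma average_of_pos (f : Lp 𝕜 p m) {α : ℝ≥0} (hα : 0 < α) :
    S.average p f α = (α : ℝ)⁻¹ • ∫ t in (0 : ℝ)..α, S.onLp p t.toNNReal f :=
  if_neg hα.ne'

lemma average_natCast_mul (f : Lp 𝕜 p m) {δ : ℝ≥0} (hδ : 0 < δ) {k : ℕ} (hk : 0 < k) :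
    S.average p f (k * δ) =
      birkhoffAverage ℝ (S.onLp p δ) _root_.id k (S.average p f δ) := by
  have hsum := intervalIntegral.sum_integral_adjacent_intervals (μ := volume) (n := k)
    (f := fun t : ℝ => S.onLp p t.toNNReal f) (a := fun j : ℕ => (j * δ : ℝ≥0))
    fun j _ => S.intervalIntegrable_onLp f _ _
  simp only [Nat.cast_zero, zero_mul, NNReal.coe_zero, Nat.cast_succ, add_mul _ (1 : ℝ≥0), one_mul,
    integral_onLp_add, onLp_natCast_mul] at hsum
  rw [S.average_of_pos f (by positivity), S.average_of_pos f hδ, birkhoffAverage, birkhoffSum,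
    ← hsum, NNReal.coe_mul, NNReal.coe_natCast, mul_inv, mul_smul, Finset.smul_sum]
  simp only [← onLp_natCast_mul, ContinuousLinearMap.map_smul_of_tower, _root_.id]

theorem tendsto_average (f : Lp 𝕜 p m) : Tendsto (S.average p f) (𝓝[>] 0) (𝓝 f) := by
  have hderiv := intervalIntegral.integral_hasDerivAt_right (S.intervalIntegrable_onLp f 0 0)
    ((S.continuous_onLp_toNNReal f).stronglyMeasurableAtFilter _ _)
    (S.continuous_onLp_toNNReal f).continuousAt
  rw [hasDerivAt_iff_tendsto_slope_zero] at hderiv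
  simp only [zero_add, intervalIntegral.integral_same, sub_zero, Real.toNNReal_zero, onLp_zero,
    ContinuousLinearMap.id_apply] at hderiv
  have hcoe : Tendsto ((↑) : ℝ≥0 → ℝ) (𝓝[>] 0) (𝓝[≠] 0) :=
    tendsto_nhdsWithin_iff.2 ⟨(NNReal.continuous_coe.tendsto 0).mono_left nhdsWithin_le_nhds,
      eventually_mem_nhdsWithin.mono fun α hα => NNReal.coe_ne_zero.2 (ne_of_gt hα)⟩
  refine (hderiv.comp hcoe).congr' ?_
  filter_upwards [self_mem_nhdsWithin] with α hα using (S.average_of_pos f hα).symm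

end ContractionSemigroup

end Semigroup

/-! ### Continuous versions of primitives -/

section Primitive

open BoundedContinuousFunction ProbabilityTheory

variable {E : Type*} [NormedAddCommGroup E] [NormedSpace ℝ E]

variable (E) in
/-- The bilinear map sending `φ` and `e` to the function `x ↦ φ x • e`. -/
noncomputable def smulConst (X : Type*) [TopologicalSpace X] :
    (X →ᵇ ℝ) →L[ℝ] E →L[ℝ] (X →ᵇ E) :=
  LinearMap.mkContinuous₂
    (LinearMap.mk₂ ℝ (fun φ e => φ • const X e) (fun φ ψ e => add_smul φ ψ _)
      (fun c φ e => by ext x; exact smul_assoc c (φ x) e)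
      (fun φ e e' => by ext x; exact smul_add (φ x) e e')
      fun c φ e => by ext x; exact smul_comm (φ x) c e)
    1 fun φ e => by
      rw [one_mul, LinearMap.mk₂_apply]
      exact (norm_smul_le φ _).trans (by gcongr; exact norm_const_le e)

lemma norm_smulConst_le {X : Type*} [TopologicalSpace X] (φ : X →ᵇ ℝ) :
    ‖smulConst E X φ‖ ≤ ‖φ‖ :=
  (ContinuousLinearMap.le_of_opNorm_le _ (LinearMap.mkContinuous₂_norm_le _ zero_le_one _) φ).trans
    (one_mul _).le

instance : IsProbabilityMeasure (expMeasure 1) := isProbabilityMeasure_expMeasure one_pos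

lemma volume_restrict_Ioc_le_expMeasure (α : ℝ) :
    volume.restrict (Ioc 0 α) ≤ ENNReal.ofReal (Real.exp α) • expMeasure 1 := by
  refine Measure.le_iff.2 fun s hs => ?_
  have hdensity : ∀ t ∈ s ∩ Ioc 0 α,
      ENNReal.ofReal (Real.exp (-α)) ≤ exponentialPDF 1 t := fun t ht => by
    rw [exponentialPDF_of_nonneg ht.2.1.le, one_mul, one_mul]
    gcongr
    exact ht.2.2
  have hle : ENNReal.ofReal (Real.exp (-α)) * volume (s ∩ Ioc 0 α) ≤ expMeasure 1 s :=
    calc _ = ∫⁻ _ in s ∩ Ioc 0 α, ENNReal.ofReal (Real.exp (-α)) := (setLIntegral_const _ _).symm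
      _ ≤ ∫⁻ t in s ∩ Ioc 0 α, exponentialPDF 1 t :=
        setLIntegral_mono' (hs.inter measurableSet_Ioc) hdensity
      _ ≤ expMeasure 1 (s ∩ Ioc 0 α) := withDensity_apply_le _ _
      _ ≤ expMeasure 1 s := measure_mono inter_subset_left
  rw [Measure.restrict_apply hs, Measure.smul_apply, smul_eq_mul]
  calc volume (s ∩ Ioc 0 α)
      = ENNReal.ofReal (Real.exp α) * (ENNReal.ofReal (Real.exp (-α)) * volume (s ∩ Ioc 0 α)) := by
        rw [← mul_assoc, ← ENNReal.ofReal_mul (Real.exp_nonneg _), ← Real.exp_add, add_neg_cancel,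
          Real.exp_zero, ENNReal.ofReal_one, one_mul]
    _ ≤ _ := by gcongr

lemma continuous_measureReal_restrict_Ioc (s : Set ℝ) :
    Continuous fun α : ℝ≥0 => (volume.restrict (Ioc 0 (α : ℝ))).real s := by
  have hprimitive := (intervalIntegral.continuous_primitive (μ := volume.restrict s)
    (fun _ _ => intervalIntegrable_const (c := (1 : ℝ))) 0).comp NNReal.continuous_coe
  refine hprimitive.congr fun α => ?_
  rw [Function.comp_apply, intervalIntegral.integral_const', Ioc_eq_empty_of_le α.coe_nonneg,
    measureReal_empty, sub_zero, smul_eq_mul, mul_one, measureReal_restrict_apply measurableSet_Ioc,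
    measureReal_restrict_apply' measurableSet_Ioc, inter_comm]

lemma exp_neg_mul_measureReal_restrict_Ioc_le (α : ℝ) (s : Set ℝ) :
    Real.exp (-α) * (volume.restrict (Ioc 0 α)).real s ≤ (expMeasure 1).real s := by
  rw [Real.exp_neg, inv_mul_le_iff₀ (Real.exp_pos α), measureReal_def, measureReal_def,
    ← ENNReal.toReal_ofReal (Real.exp_nonneg α), ← ENNReal.toReal_mul]
  exact ENNReal.toReal_mono (ENNReal.mul_ne_top ENNReal.ofReal_ne_top (measure_ne_top _ s))
    (volume_restrict_Ioc_le_expMeasure α s)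

/-- The function `α ↦ exp (-α) * |s ∩ (0, α]|`; the exponential factor makes it bounded, by the
measure of `s` for the exponential distribution. -/
noncomputable def discountedLength (s : Set ℝ) : ℝ≥0 →ᵇ ℝ :=
  ofNormedAddCommGroup (fun α => Real.exp (-α) * (volume.restrict (Ioc 0 (α : ℝ))).real s)
    ((by fun_prop : Continuous fun α : ℝ≥0 => Real.exp (-α)).mul
      (continuous_measureReal_restrict_Ioc s)) ((expMeasure 1).real s) fun α => by
    rw [Real.norm_of_nonneg (by positivity)]
    exact exp_neg_mul_measureReal_restrict_Ioc_le α s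

lemma norm_discountedLength_le (s : Set ℝ) : ‖discountedLength s‖ ≤ (expMeasure 1).real s :=
  norm_ofNormedAddCommGroup_le _ measureReal_nonneg _

lemma discountedLength_union {s t : Set ℝ} (ht : MeasurableSet t) (hst : Disjoint s t) :
    discountedLength (s ∪ t) = discountedLength s + discountedLength t := by
  ext α
  change Real.exp (-α) * _ = Real.exp (-α) * _ + Real.exp (-α) * _
  rw [measureReal_union hst ht, mul_add]

variable {Ω : Type*} [MeasurableSpace Ω] {m : Measure Ω} {p : ℝ≥0∞} [Fact (1 ≤ p)]

variable (E p m) in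
/-- The operator from `L^p(E)` to `L^p(C(ℝ≥0, E))` given by multiplication with
`discountedLength s`. Integrating against this operator-valued measure yields an element of
`L^p(C(ℝ≥0, E))` which evaluates at `α` to `exp (-α)` times the integral over `(0, α]`; its values
are continuous functions, so it is a version of the primitive with continuous paths. -/
noncomputable def discountedLengthSMul (s : Set ℝ) : Lp E p m →L[ℝ] Lp (ℝ≥0 →ᵇ E) p m :=
  (smulConst E ℝ≥0 (discountedLength s)).compLpL p m

lemma dominatedFinMeasAdditive_discountedLengthSMul :
    DominatedFinMeasAdditive (expMeasure 1) (discountedLengthSMul E m p) 1 := by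
  refine ⟨fun s t _ ht _ _ hst => ?_, fun s _ _ => ?_⟩
  · rw [discountedLengthSMul, discountedLength_union ht hst, map_add,
      ContinuousLinearMap.add_compLpL]
    rfl
  · rw [one_mul]
    exact (ContinuousLinearMap.norm_compLpL_le _).trans
      ((norm_smulConst_le _).trans (norm_discountedLength_le s))

lemma evalCLM_discountedLengthSMul (α : ℝ≥0) (s : Set ℝ) (f : Lp E p m) :
    (evalCLM ℝ α).compLpL p m (discountedLengthSMul E m p s f) =
      Real.exp (-α) • (volume.restrict (Ioc 0 (α : ℝ))).real s • f := by
  refine Lp.ext ?_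
  filter_upwards [(evalCLM ℝ α).coeFn_compLpL (discountedLengthSMul E m p s f),
    (smulConst E ℝ≥0 (discountedLength s)).coeFn_compLpL f,
    Lp.coeFn_smul (Real.exp (-α)) ((volume.restrict (Ioc 0 (α : ℝ))).real s • f),
    Lp.coeFn_smul ((volume.restrict (Ioc 0 (α : ℝ))).real s) f] with x heval hsmul hexp hlength
  rw [heval, discountedLengthSMul, hsmul, hexp, Pi.smul_apply, hlength]
  exact mul_smul _ _ _

lemma continuous_setIntegral_Ioc_expMeasure {G : Type*} [NormedAddCommGroup G] [NormedSpace ℝ G]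
    (α : ℝ) : Continuous fun F : Lp G 1 (expMeasure 1) => ∫ t in Ioc 0 α, F t := by
  have hle := volume_restrict_Ioc_le_expMeasure α
  refine (continuous_integral.comp
    (continuous_L1_toL1 _ ENNReal.ofReal_ne_top hle)).congr fun F => ?_
  exact integral_congr_ae (Integrable.coeFn_toL1 _)

variable [CompleteSpace E]

lemma evalCLM_setToFun_discountedLengthSMul (α : ℝ≥0) {F : ℝ → Lp E p m}
    (hF : Integrable F (expMeasure 1)) :
    (evalCLM ℝ α).compLpL p m (setToFun (expMeasure 1) (discountedLengthSMul E m p)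
      dominatedFinMeasAdditive_discountedLengthSMul F) =
      Real.exp (-α) • ∫ t in Ioc 0 (α : ℝ), F t := by
  have hT := dominatedFinMeasAdditive_discountedLengthSMul (E := E) (m := m) (p := p)
  have hle := volume_restrict_Ioc_le_expMeasure α
  have hfinite {F : ℝ → Lp E p m} (hF : Integrable F (expMeasure 1)) :
      IntegrableOn F (Ioc 0 (α : ℝ)) := hF.of_measure_le_smul ENNReal.ofReal_ne_top hle
  refine hF.induction (P := fun F => (evalCLM ℝ α).compLpL p m (setToFun (expMeasure 1) _ hT F) =
    Real.exp (-α) • ∫ t in Ioc 0 (α : ℝ), F t) (fun f s hs hlt => ?_)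
    (fun F G _ hF hG ihF ihG => ?_) ?_ fun F G hFG _ ih => ?_
  · rw [setToFun_indicator_const hT hs hlt.ne, evalCLM_discountedLengthSMul,
      integral_indicator_const f hs]
  · rw [setToFun_add hT hF hG, map_add, ihF, ihG, ← smul_add,
      ← integral_add' (hfinite hF) (hfinite hG)]
  · exact isClosed_eq ((ContinuousLinearMap.continuous _).comp (continuous_setToFun hT))
      ((continuous_const_smul (Real.exp (-α : ℝ))).comp
        (continuous_setIntegral_Ioc_expMeasure (α : ℝ)))
  · rw [← setToFun_congr_ae hT hFG, ih, integral_congr_ae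
      ((Measure.absolutelyContinuous_of_le_smul hle).ae_eq hFG)]

theorem exists_continuous_setIntegral_Ioc {F : ℝ → Lp E p m} (hF : Integrable F (expMeasure 1)) :
    ∃ v : ℝ≥0 → Ω → E, (∀ α : ℝ≥0, v α =ᵐ[m] (∫ t in Ioc 0 (α : ℝ), F t : Lp E p m)) ∧
      ∀ x, Continuous fun α => v α x := by
  set V := setToFun (expMeasure 1) (discountedLengthSMul E m p)
    dominatedFinMeasAdditive_discountedLengthSMul F
  refine ⟨fun α x => Real.exp α • V x α, fun α => ?_, fun x =>
    (by fun_prop : Continuous fun α : ℝ≥0 => Real.exp α).smul (V x).continuous⟩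
  have heval := evalCLM_setToFun_discountedLengthSMul α hF
  filter_upwards [(evalCLM ℝ α).coeFn_compLpL V,
    Lp.coeFn_smul (Real.exp (-α)) (∫ t in Ioc 0 (α : ℝ), F t)] with x hV hsmul
  rw [heval, hsmul, Pi.smul_apply, evalCLM_apply] at hV
  rw [← hV, smul_smul, ← Real.exp_add, add_neg_cancel, Real.exp_zero, one_smul]

end Primitive

/-! ### The maximal function -/

section DyadicSup

/-- The supremum of `g` over the positive multiples of `2⁻ʲ`. -/
noncomputable def dyadicSup (j : ℕ) (g : ℝ≥0 → ℝ≥0∞) : ℝ≥0∞ :=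
  ⨆ k : ℕ, g ((k + 1 : ℕ) * (2 ^ j)⁻¹)

lemma monotone_dyadicSup (g : ℝ≥0 → ℝ≥0∞) : Monotone fun j => dyadicSup j g := by
  refine monotone_nat_of_le_succ fun j => iSup_le fun k => le_iSup_of_le (2 * k + 1) (le_of_eq ?_)
  congr 1
  push_cast
  field_simp
  ring

lemma tendsto_sup_range (g : ℕ → ℝ≥0∞) :
    Tendsto (fun K => (Finset.range K).sup g) atTop (𝓝 (⨆ k, g k)) := by
  have hsup := (tendsto_atTop_iSup fun _ _ hst => Finset.sup_mono (f := g) hst).comp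
    tendsto_finset_range
  simpa only [Finset.sup_eq_iSup, ← iSup_eq_iSup_finset, Function.comp_def] using hsup

lemma tendsto_inv_two_pow : Tendsto (fun j : ℕ => ((2 : ℝ≥0) ^ j)⁻¹) atTop (𝓝 0) := by
  simpa only [inv_pow] using NNReal.tendsto_pow_atTop_nhds_zero_of_lt_one two_inv_lt_one

lemma tendsto_natCeil_mul_inv_two_pow (α : ℝ≥0) :
    Tendsto (fun j : ℕ => (⌈α * 2 ^ j⌉₊ : ℝ≥0) * (2 ^ j)⁻¹) atTop (𝓝 α) := by
  refine tendsto_of_tendsto_of_tendsto_of_le_of_le tendsto_const_nhds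
    (by simpa only [add_zero] using tendsto_inv_two_pow.const_add α) (fun j => ?_) fun j => ?_
  · exact (le_mul_inv_iff₀ (by positivity)).2 (Nat.le_ceil _)
  · rw [mul_inv_le_iff₀ (by positivity), add_mul, inv_mul_cancel₀ (by positivity)]
    exact (Nat.ceil_lt_add_one (by positivity)).le

lemma le_iSup_dyadicSup {g : ℝ≥0 → ℝ≥0∞} (hg : ContinuousOn g (Ioi 0)) {α : ℝ≥0} (hα : 0 < α) :
    g α ≤ ⨆ j, dyadicSup j g := by
  refine le_of_tendsto ((hg.continuousAt (Ioi_mem_nhds hα)).tendsto.comp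
    (tendsto_natCeil_mul_inv_two_pow α)) (.of_forall fun j => le_iSup_of_le j ?_)
  have hceil : 0 < ⌈α * 2 ^ j⌉₊ := Nat.ceil_pos.2 (by positivity)
  obtain ⟨k, hk⟩ := Nat.exists_eq_succ_of_ne_zero hceil.ne'
  exact le_iSup_of_le k (by rw [Function.comp_apply, hk])

lemma iSup_eq_iSup_dyadicSup {g : ℝ≥0 → ℝ≥0∞} (hg : ContinuousOn g (Ioi 0))
    (h0 : g 0 ≤ ⨆ j, dyadicSup j g) : ⨆ α, g α = ⨆ j, dyadicSup j g := by
  refine le_antisymm (iSup_le fun α => ?_) (iSup_le fun j => iSup_le fun k => le_iSup g _)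
  rcases eq_zero_or_pos α with rfl | hα
  exacts [h0, le_iSup_dyadicSup hg hα]

end DyadicSup

namespace ContractionSemigroup

variable {𝕜 : Type*} [RCLike 𝕜] {Ω : Type*} [MeasurableSpace Ω] {m : Measure Ω}
  (S : ContractionSemigroup 𝕜 m) {p : ℝ≥0} [Fact (1 ≤ (p : ℝ≥0∞))]

lemma average_zero (f : Lp 𝕜 p m) : S.average p f 0 = f := if_pos rfl

lemma integrable_onLp (f : Lp 𝕜 p m) (μ : Measure ℝ) [IsFiniteMeasure μ] :
    Integrable (fun t : ℝ => S.onLp p t.toNNReal f) μ := by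
  obtain ⟨K, hK⟩ := S.exists_forall_norm_onLp_le p
  exact .of_bound (S.continuous_onLp_toNNReal f).aestronglyMeasurable (K * ‖f‖)
    (.of_forall fun t => hK _ f)

theorem exists_isAverageVersion (f : Lp 𝕜 p m) : ∃ u : ℝ≥0 → Ω → 𝕜, S.IsAverageVersion p f u := by
  obtain ⟨v, hv, hcont⟩ := exists_continuous_setIntegral_Ioc
    (S.integrable_onLp f (ProbabilityTheory.expMeasure 1))
  refine ⟨fun α x => if α = 0 then f x else (α : ℝ)⁻¹ • v α x, fun α => ?_,
    .of_forall fun x => ?_⟩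
  · rcases eq_zero_or_pos α with rfl | hα
    · simp only [if_true, average_zero]
      rfl
    · simp only [if_neg hα.ne', S.average_of_pos f hα,
        intervalIntegral.integral_of_le α.coe_nonneg]
      filter_upwards [hv α, Lp.coeFn_smul (α : ℝ)⁻¹ (∫ t in Ioc 0 (α : ℝ), S.onLp p t.toNNReal f)]
        with x hvx hsmul
      rw [hvx, hsmul, Pi.smul_apply]
  · have hsmul : ContinuousOn (fun α : ℝ≥0 => (α : ℝ)⁻¹ • v α x) (Ioi 0) :=
      (NNReal.continuous_coe.continuousOn.inv₀ fun α hα => NNReal.coe_ne_zero.2 (ne_of_gt hα)).smul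
        (hcont x).continuousOn
    exact hsmul.congr fun α hα => if_neg (ne_of_gt hα)

lemma tendsto_average_inv_two_pow (f : Lp 𝕜 p m) :
    Tendsto (fun j : ℕ => S.average p f (2 ^ j)⁻¹) atTop (𝓝 f) :=
  (S.tendsto_average f).comp (tendsto_nhdsWithin_iff.2
    ⟨tendsto_inv_two_pow, .of_forall fun j => mem_Ioi.2 (by positivity)⟩)

lemma ae_enorm_le_iSup_dyadicSup_average (f : Lp 𝕜 p m) :
    ∀ᵐ x ∂m, ‖f x‖ₑ ≤ ⨆ j, dyadicSup j fun α => ‖S.average p f α x‖ₑ := by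
  obtain ⟨ns, -, hns⟩ :=
    (tendstoInMeasure_of_tendsto_Lp (S.tendsto_average_inv_two_pow f)).exists_seq_tendsto_ae
  filter_upwards [hns] with x hx
  refine le_of_tendsto hx.enorm (.of_forall fun i => le_iSup_of_le (ns i) (le_iSup_of_le 0 ?_))
  rw [zero_add, Nat.cast_one, one_mul]

lemma IsMaximalFunction.ae_eq_iSup_dyadicSup {f : Lp 𝕜 p m} {M : Ω → ℝ≥0∞}
    (hM : S.IsMaximalFunction p f M) :
    M =ᵐ[m] fun x => ⨆ j, dyadicSup j fun α => ‖S.average p f α x‖ₑ := by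
  obtain ⟨u, ⟨hu, hcont⟩, hMu⟩ := hM
  have hgrid : ∀ᵐ x ∂m, ∀ j k : ℕ, u ((k + 1 : ℕ) * (2 ^ j)⁻¹) x =
      S.average p f ((k + 1 : ℕ) * (2 ^ j)⁻¹) x :=
    ae_all_iff.2 fun j => ae_all_iff.2 fun k => hu _
  filter_upwards [hMu, hcont, hgrid, hu 0, S.ae_enorm_le_iSup_dyadicSup_average f]
    with x hMx hcontx hgridx hu0 hfx
  have hdyadic : ∀ j, dyadicSup j (fun α => ‖u α x‖ₑ) =
      dyadicSup j fun α => ‖S.average p f α x‖ₑ := fun j => by simp only [dyadicSup, hgridx]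
  rw [hMx, iSup_eq_iSup_dyadicSup hcontx.enorm (by simpa only [hdyadic, hu0, average_zero])]
  simp only [hdyadic]

lemma aemeasurable_dyadicSup_average (f : Lp 𝕜 p m) (j : ℕ) :
    AEMeasurable (fun x => dyadicSup j fun α => ‖S.average p f α x‖ₑ) m :=
  .iSup fun _ => (Lp.aestronglyMeasurable _).enorm

lemma IsMaximalFunction.aemeasurable {f : Lp 𝕜 p m} {M : Ω → ℝ≥0∞}
    (hM : S.IsMaximalFunction p f M) : AEMeasurable M m :=
  (AEMeasurable.iSup fun j => S.aemeasurable_dyadicSup_average f j).congr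
    hM.ae_eq_iSup_dyadicSup.symm

variable {κ : Type*} {q : ℝ≥0}

lemma mixedNorm_dyadicSup_average_le (hp : 1 < p) (hpq : p ≤ q) (s : Finset κ) (f : κ → Lp 𝕜 p m)
    (j : ℕ) : mixedNorm p q m s (fun n x => dyadicSup j fun α => ‖S.average p (f n) α x‖ₑ) ≤
      ENNReal.ofReal (p / (p - 1)) *
        mixedNorm p q m s (fun n x => ‖S.average p (f n) (2 ^ j)⁻¹ x‖ₑ) := by
  refine mixedNorm_le_of_tendsto (NNReal.coe_pos.2 (zero_lt_one.trans hp))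
    (u := fun K n x => (Finset.range K).sup fun k =>
      ‖S.average p (f n) ((k + 1 : ℕ) * (2 ^ j)⁻¹) x‖ₑ)
    (fun K n _ => ?_) (fun n _ => .of_forall fun x => ?_) fun K => ?_
  · simp only [Finset.sup_eq_iSup]
    exact .iSup fun _ => .iSup fun _ => (Lp.aestronglyMeasurable _).enorm
  · exact tendsto_sup_range _
  · simp only [S.average_natCast_mul _ (by positivity : (0 : ℝ≥0) < (2 ^ j)⁻¹) (Nat.succ_pos _)]
    exact (S.isDunfordSchwartz_onLp _).mixedNorm_birkhoffAverage_le hp hpq _ K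

lemma mixedNorm_iSup_dyadicSup_average_le (hp : 1 < p) (hpq : p ≤ q) (s : Finset κ)
    (f : κ → Lp 𝕜 p m) :
    mixedNorm p q m s (fun n x => ⨆ j, dyadicSup j fun α => ‖S.average p (f n) α x‖ₑ) ≤
      ENNReal.ofReal (p / (p - 1)) * mixedNorm p q m s (fun n x => ‖f n x‖ₑ) := by
  have hp0 : (0 : ℝ) < p := NNReal.coe_pos.2 (zero_lt_one.trans hp)
  have hq : 1 ≤ q := hp.le.trans hpq
  have hlim := ENNReal.Tendsto.const_mul (a := ENNReal.ofReal (p / (p - 1)))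
    (tendsto_mixedNorm_enorm (s := s) (NNReal.one_le_coe.2 hq)
      fun n _ => S.tendsto_average_inv_two_pow (f n)) (Or.inr ENNReal.ofReal_ne_top)
  refine mixedNorm_le_of_tendsto hp0 (fun j n _ => S.aemeasurable_dyadicSup_average (f n) j)
    (fun n _ => .of_forall fun x => tendsto_atTop_iSup (monotone_dyadicSup _)) fun j => ?_
  refine ge_of_tendsto hlim ((eventually_ge_atTop j).mono fun i hi => ?_)
  exact (mixedNorm_mono_ae hp0 (NNReal.coe_pos.2 (zero_lt_one.trans_le hq)) fun n _ =>
    .of_forall fun x => monotone_dyadicSup _ hi).trans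
      (S.mixedNorm_dyadicSup_average_le hp hpq s f i)

theorem mixedNorm_le_of_isMaximalFunction (hp : 1 < p) (hpq : p ≤ q) (s : Finset κ)
    {f : κ → Lp 𝕜 p m} {M : κ → Ω → ℝ≥0∞} (hM : ∀ n, S.IsMaximalFunction p (f n) (M n)) :
    mixedNorm p q m s M ≤
      ENNReal.ofReal (p / (p - 1)) * mixedNorm p q m s (fun n x => ‖f n x‖ₑ) :=
  (mixedNorm_congr_ae fun n _ => (hM n).ae_eq_iSup_dyadicSup).trans_le
    (S.mixedNorm_iSup_dyadicSup_average_le hp hpq s f)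

end ContractionSemigroup

end HopfDunfordSchwartz

theorem mainTheorem1 (p q : ℝ≥0) [Fact (1 ≤ (p : ℝ≥0∞))] (hp : 1 < p) (hpq : p ≤ q) :
    ∃ C : ℝ≥0, ∀ (𝕜 : Type*) [RCLike 𝕜] (Ω : Type*) [MeasurableSpace Ω] (m : Measure Ω)
      (S : HopfDunfordSchwartz.ContractionSemigroup 𝕜 m) (f : ℕ → Ω → 𝕜)
      (hf : HopfDunfordSchwartz.MemLpLq p q m f),
      (∀ (n : ℕ) (α : ℝ≥0), IntervalIntegrable
        (fun t : ℝ => S.onLp p t.toNNReal ((hf.memLp hpq n).toLp (f n))) volume 0 α) ∧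
      (∀ n : ℕ, ∃ M : Ω → ℝ≥0∞, S.IsMaximalFunction p ((hf.memLp hpq n).toLp (f n)) M) ∧
      ∀ M : ℕ → Ω → ℝ≥0∞,
        (∀ n : ℕ, S.IsMaximalFunction p ((hf.memLp hpq n).toLp (f n)) (M n)) →
        (∀ n : ℕ, AEMeasurable (M n) m) ∧
        HopfDunfordSchwartz.lpLqNorm p q m M ≤
          C * HopfDunfordSchwartz.lpLqNorm p q m (fun n x => ‖f n x‖ₑ) := by
  refine ⟨(p / (p - 1) : ℝ).toNNReal, fun 𝕜 _ Ω _ m S f hf => ⟨fun n α =>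
    S.intervalIntegrable_onLp _ _ _, fun n => ?_, fun M hM => ?_⟩⟩
  · obtain ⟨u, hu⟩ := S.exists_isAverageVersion ((hf.memLp hpq n).toLp (f n))
    exact ⟨_, u, hu, .of_forall fun _ => rfl⟩
  have hmeas : ∀ n, AEMeasurable (M n) m := fun n => (hM n).aemeasurable
  refine ⟨hmeas, HopfDunfordSchwartz.lpLqNorm_le_of_forall_mixedNorm_le q (zero_lt_one.trans hp)
    hmeas fun N => ?_⟩
  have hversion : ∀ n ∈ Finset.range N, (fun x => ‖(hf.memLp hpq n).toLp (f n) x‖ₑ) =ᵐ[m]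
      fun x => ‖f n x‖ₑ := fun n _ => (hf.memLp hpq n).coeFn_toLp.fun_comp _
  calc HopfDunfordSchwartz.mixedNorm p q m (Finset.range N) M
      ≤ ENNReal.ofReal (p / (p - 1)) *
        HopfDunfordSchwartz.mixedNorm p q m (Finset.range N) (fun n x => ‖f n x‖ₑ) :=
        (S.mixedNorm_le_of_isMaximalFunction hp hpq _ hM).trans_eq
          (congrArg _ (HopfDunfordSchwartz.mixedNorm_congr_ae hversion))
    _ ≤ _ := mul_le_mul_right (HopfDunfordSchwartz.mixedNorm_le_lpLqNorm p q _ _) _
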